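/- Let $\mathcal H$ be a real Hilbert space and $N\ge 1$. Let $\mathcal Q\subset\mathcal H$ be nonempty, closed and convex, let $h\colon\mathcal H\to\mathbb R$ be convex and differentiable with $\beta^{-1}$-Lipschitz gradient for some $\beta>0$, and let $f_1,\dots,f_N\colon\mathcal H\to\mathbb R$ be convex and lower semicontinuous (for example $f_i(x)=\langle a_i,x\rangle+\xi_i$). Let $q,\xi\in\mathbb R^N$ and $\mu_-,\mu_+\in\mathbb R$, and put $$\mathcal P_1=\Big\{p\in\mathbb R^N:\sum_{i=1}^N p_i=1\Big\},\quad \mathcal P_2=\{p\in\mathbb R^N: p\le q\},\quad \mathcal P_3=\Big\{p\in\mathbb R^N:\mu_-\le\sum_{i=1}^N p_i\xi_i\le\mu_+\Big\}.$$ Write $N_S$ for the normal cone of a convex set $S$, $\operatorname{proj}_S$ for the projection onto $S$, $\partial$ for the convex subdifferential, $J_{\lambda B}=(\mathrm{Id}+\lambda B)^{-1}$ for the resolvent, $\phi=\iota_{\mathbb R_-}$ for the indicator function of $]-\infty,0]$, $\phi^*$ for its conjugate, and $e_i$ for the canonical vectors of $\mathbb R^N$. On the Hilbert space $\mathbf H=\mathcal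 H\times\mathbb R^N$ define $$A_1(x,p)=N_{\mathcal Q}(x)\times N_{\mathcal P_1}(p),\quad A_2(x,p)=\{0\}\times N_{\mathcal P_2}(p),\quad A_3(x,p)=\{0\}\times N_{\mathcal P_3}(p),$$ $$B_i(x,p)=p_i\,\partial f_i(x)\times\big(\partial\phi^*(p_i)e_i-f_i(x)e_i\big)\quad(1\le i\le N),\qquad C_1(x,p)=(\nabla h(x),0),\quad C_i=0\quad(2\le i\le N+1).$$ For $m\in\{2,3\}$ consider the inclusion $$(\mathrm I_m)\qquad 0\in A_1(x,p)+A_m(x,p)+\sum_{i=1}^N B_i(x,p)+\sum_{i=1}^{N+1}C_i(x,p).$$ Let $\lambda\in\,]0,2\beta[$, let $\gamma\in\,\big]0,1-\tfrac{\lambda}{2\beta}\big[$, let $((\overline x_1^0,\overline p_1^0),\dots,(\overline x_{N+1}^0,\overline p_{N+1}^0))\in\mathbf H^{N+1}$ be arbitrary, and for a set $\mathcal P\subset\mathbb R^N$ and all $k\in\mathbb N$ consider the routine $$\begin{aligned} &x_1^k=\operatorname{proj}_{\mathcal Q}(\overline x_1^k),\qquad p_1^k=\operatorname{proj}_{\mathcal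 P_1}(\overline p_1^k),\\ &(x_2^k,p_2^k)=\big(\overline x_2^k+x_1^k-\overline x_1^k-\lambda\nabla h(x_1^k),\ \operatorname{proj}_{\mathcal P}(\overline p_2^k+p_1^k-\overline p_1^k)\big),\\ &(x_i^k,p_i^k)=J_{\lambda B_{i-2}}\big(\overline x_i^k+x_{i-1}^k-\overline x_{i-1}^k,\ \overline p_i^k+p_{i-1}^k-\overline p_{i-1}^k\big),\qquad 3\le i\le N+1,\\ &(x_{N+2}^k,p_{N+2}^k)=J_{\lambda B_N}\big(x_1^k+x_{N+1}^k-\overline x_{N+1}^k,\ p_1^k+p_{N+1}^k-\overline p_{N+1}^k\big),\\ &(\overline x_j^{k+1},\overline p_j^{k+1})=(\overline x_j^k,\overline p_j^k)+\gamma\,(x_{j+1}^k-x_j^k,\ p_{j+1}^k-p_j^k),\qquad 1\le j\le N+1. \end{aligned}$$ Then the following hold. 1. If $\mathcal P=\mathcal P_2$ and $(\mathrm I_2)$ has a solution, then there is a solution $(x,p)\in\mathbf H$ of $(\mathrm I_2)$ such that $(x_1^k,p_1^k)\rightharpoonup(x,p)$. 2. If $\mathcal P=\mathcal P_3$ and $(\mathrm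 I_3)$ has a solution, then there is a solution $(x,p)\in\mathbf H$ of $(\mathrm I_3)$ such that $(x_1^k,p_1^k)\rightharpoonup(x,p)$. -/

import Mathlib

open Set Filter Topology
open scoped Pointwise

namespace DRO

noncomputable section

section General

variable {E : Type*} [NormedAddCommGroup E] [InnerProductSpace ℝ E]

/-- The indicator function of a set: `0` on `s` and `+∞` outside. -/
def indicatorFun (s : Set E) (x : E) : EReal :=
  open Classical in if x ∈ s then 0 else ⊤

/-- The conjugate `g*(u) = sup_x (⟨u, x⟩ - g x)`. -/
def conjugate (g : E → EReal) (u : E) : EReal :=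
  ⨆ x : E, (((inner ℝ u x : ℝ) : EReal) - g x)

/-- The convex subdifferential of a proper extended-real-valued function. -/
def subdiff (g : E → EReal) (x : E) : Set E :=
  {u | ∀ y : E, ((inner ℝ u (y - x) : ℝ) : EReal) + g x ≤ g y}

/-- The normal cone to `s` at `x`; it is empty if `x ∉ s`. -/
def normalCone (s : Set E) (x : E) : Set E :=
  {u | x ∈ s ∧ ∀ y ∈ s, inner ℝ u (y - x) ≤ (0 : ℝ)}

/-- The projection `argmin_{y ∈ s} ‖x - y‖` (unique for nonempty closed convex `s` in a
Hilbert space). -/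
def proj (s : Set E) (x : E) : E :=
  Classical.epsilon fun y => y ∈ s ∧ ∀ w ∈ s, ‖x - y‖ ≤ ‖x - w‖

/-- The resolvent `J_{lam A} = (Id + lam A)⁻¹` of a set-valued operator `A`, that is, the point `y`
with `z ∈ y + lam A y` (unique for maximally monotone `A` and `lam > 0`). -/
def resolvent (lam : ℝ) (A : E → Set E) (z : E) : E :=
  Classical.epsilon fun y => z ∈ {y} + lam • A y

end General

/-- `ℝ^N` with its Euclidean norm. -/
abbrev RN (N : ℕ) := EuclideanSpace ℝ (Fin N)

/-- The Hilbert product space `H × ℝ^N`. -/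
abbrev HR (H : Type*) (N : ℕ) := WithLp 2 (H × RN N)

/-- `P₁`: vectors whose coordinates sum to one. -/
def P1 (N : ℕ) : Set (RN N) := {p | ∑ i, p i = 1}

/-- `P₂`: vectors that are coordinatewise at most `q`. -/
def P2 {N : ℕ} (q : RN N) : Set (RN N) := {p | ∀ i, p i ≤ q i}

/-- `P₃`: the moment set. -/
def P3 {N : ℕ} (ξ : RN N) (μm μp : ℝ) : Set (RN N) :=
  {p | μm ≤ ∑ i, p i * ξ i ∧ ∑ i, p i * ξ i ≤ μp}

/-- The indicator function of the nonpositive half-line. -/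
def phi : ℝ → EReal := indicatorFun (Set.Iic (0 : ℝ))

section Operators

variable {H : Type*} [NormedAddCommGroup H] [InnerProductSpace ℝ H] {N : ℕ}

/-- `A₁(x, p) = N_Q(x) × N_{P₁}(p)`. -/
def opA1 (Q : Set H) (z : HR H N) : Set (HR H N) :=
  {w | w.fst ∈ normalCone Q z.fst ∧ w.snd ∈ normalCone (P1 N) z.snd}

/-- `(x, p) ↦ {0} × N_P(p)`; this is `A₂` for `P = P₂` and `A₃` for `P = P₃`. -/
def opA (P : Set (RN N)) (z : HR H N) : Set (HR H N) :=
  {w | w.fst = 0 ∧ w.snd ∈ normalCone P z.snd}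

/-- `B_i(x, p) = p_i ∂f_i(x) × (∂φ*(p_i) e_i - f_i(x) e_i)`. -/
def opB (f : Fin N → H → ℝ) (i : Fin N) (z : HR H N) : Set (HR H N) :=
  {w | w.fst ∈ z.snd i • subdiff (fun x => ((f i x : ℝ) : EReal)) z.fst ∧
    ∃ s ∈ subdiff (conjugate phi) (z.snd i),
      w.snd = EuclideanSpace.single i s - EuclideanSpace.single i (f i z.fst)}

/-- `C(x, p) = (∇h(x), 0)`. -/
def opC [CompleteSpace H] (h : H → ℝ) (z : HR H N) : HR H N :=
  WithLp.toLp 2 (gradient h z.fst, 0)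

/-- The family `C₁ = C`, `C_i = 0` for `i ≥ 2`. -/
def opCi [CompleteSpace H] (h : H → ℝ) (i : ℕ) (z : HR H N) : HR H N :=
  if i = 1 then opC h z else 0

/-- `z = (x, p)` solves
`0 ∈ A₁(x, p) + A(x, p) + ∑_{i=1}^N B_i(x, p) + ∑_{i=1}^{N+1} C_i(x, p)`, where
`A(x, p) = {0} × N_P(p)`. -/
def SolvesInclusion [CompleteSpace H] (Q : Set H) (h : H → ℝ) (f : Fin N → H → ℝ)
    (P : Set (RN N)) (z : HR H N) : Prop :=
  (0 : HR H N) ∈ opA1 Q z + opA P z + (∑ i : Fin N, opB f i z) +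
    {∑ i ∈ Finset.Icc 1 (N + 1), opCi h i z}

/-- The extended distributed forward-backward routine with the extra projection onto `P`.
Here `zbar k j = (x̄_j^k, p̄_j^k)` for `1 ≤ j ≤ N + 1` and `z k i = (x_i^k, p_i^k)` for
`1 ≤ i ≤ N + 2`; other values of the second index play no role. The `Fin N` index `i` (counted
from `0`) stands for the operator `B_{i+1}`. -/
structure IsRoutine [CompleteSpace H] (Q : Set H) (h : H → ℝ) (f : Fin N → H → ℝ)
    (P : Set (RN N)) (lam γ : ℝ) (zbar z : ℕ → ℕ → HR H N) : Prop where
  first : ∀ k, z k 1 = WithLp.toLp 2 (proj Q (zbar k 1).fst, proj (P1 N) (zbar k 1).snd)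
  second : ∀ k, z k 2 = WithLp.toLp 2
    ((zbar k 2).fst + (z k 1).fst - (zbar k 1).fst - lam • gradient h (z k 1).fst,
      proj P ((zbar k 2).snd + (z k 1).snd - (zbar k 1).snd))
  middle : ∀ k, ∀ i : Fin N, (i : ℕ) + 1 < N →
    z k (i + 3) = resolvent lam (opB f i) (zbar k (i + 3) + z k (i + 2) - zbar k (i + 2))
  last : ∀ k, ∀ i : Fin N, (i : ℕ) + 1 = N →
    z k (N + 2) = resolvent lam (opB f i) (z k 1 + z k (N + 1) - zbar k (N + 1))
  update : ∀ k j, 1 ≤ j → j ≤ N + 1 →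
    zbar (k + 1) j = zbar k j + γ • (z k (j + 1) - z k j)

/-- Weak convergence of a sequence, that is, convergence in the weak topology. -/
def WeaklyConverges {E : Type*} [NormedAddCommGroup E] [InnerProductSpace ℝ E]
    (u : ℕ → E) (x : E) : Prop :=
  Tendsto (fun k => toWeakSpace ℝ E (u k)) atTop (𝓝 (toWeakSpace ℝ E x))

end Operators

end

end DRO

/-! The routine is a forward-backward splitting on a ring of monotone operators: after scaling by
the step size, every update is a resolvent step, with one cocoercive forward term. A stationary
configuration is a point `y` with governing points `w`; its residuals telescope, so such
configurations exist over `y` exactly when `y` solves the inclusion (`exists_isStationary_iff`).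

Convergence combines Fejér monotonicity with Opial's argument. Summation by parts (`ring_identity`)
and monotonicity show that the squared distance of the governing points to any stationary
configuration decreases, with a gain controlling the steps and the forward errors (`exists_fejer`).
Hence consecutive iterates merge and everything is bounded. Weak ultrafilter limits are stationary
(`IsWeakLimit.isStationary`): single products of weakly convergent residuals and iterates need not
converge, but their sum around the ring tends to zero, which is enough for a Minty-type argument.
Convergence of the distances makes all these limits coincide.

It remains to check the hypotheses on the concrete operators. The gradient is cocoercive by
Baillon–Haddad (`gradient_cocoercive`). The operator `opB` is the saddle operator of `p * f x` with
`p ≥ 0`; eliminating `p` turns its resolvent into a strongly convex minimisation over `H`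
(`exists_saddle_resolvent`). -/

namespace DRO

/-! ### Weak compactness along ultrafilters. -/

section WeakLimits

variable {E : Type*} [NormedAddCommGroup E] [InnerProductSpace ℝ E]

/-- A bounded family in a Hilbert space converges weakly along every ultrafilter. -/
theorem exists_weak_limit [CompleteSpace E] {ι : Type*} (U : Ultrafilter ι) (u : ι → E) (R : ℝ)
    (hu : ∀ k, ‖u k‖ ≤ R) :
    ∃ x : E, ∀ y, Tendsto (fun k => inner ℝ (u k) y) U (𝓝 (inner ℝ x y)) := by
  have hc := WeakDual.isCompact_closedBall (𝕜 := ℝ) (0 : StrongDual ℝ E) R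
  let g : ι → WeakDual ℝ E := fun k =>
    StrongDual.toWeakDual (InnerProductSpace.toDual ℝ E (u k))
  obtain ⟨x', -, hx'⟩ := hc.ultrafilter_le_nhds (U.map g) (by
    rw [le_principal_iff]
    refine Ultrafilter.mem_map.2 (univ_mem' fun k => ?_)
    simpa [g] using hu k)
  refine ⟨(InnerProductSpace.toDual ℝ E).symm (WeakDual.toStrongDual x'), fun y => ?_⟩
  have h1 : Tendsto g U (𝓝 x') := hx'
  have h2 := ((WeakDual.eval_continuous y).tendsto x').comp h1
  rw [InnerProductSpace.toDual_symm_apply]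
  exact h2

theorem tendsto_inner_zero_of_bounded {ι : Type*} {l : Filter ι} {u v : ι → E} (R : ℝ)
    (hu : Tendsto (fun k => ‖u k‖) l (𝓝 0)) (hv : ∀ k, ‖v k‖ ≤ R) :
    Tendsto (fun k => inner ℝ (u k) (v k)) l (𝓝 0) := by
  refine squeeze_zero_norm (a := fun k => ‖u k‖ * R) (fun k => ?_) (by simpa using hu.mul_const R)
  exact (norm_inner_le_norm _ _).trans (mul_le_mul_of_nonneg_left (hv k) (norm_nonneg _))

end WeakLimits

/-! ### The ring splitting and its Fejér monotonicity. -/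

section Splitting

variable {E : Type*} [NormedAddCommGroup E] [InnerProductSpace ℝ E]

/-- Summation by parts for the residuals of the ring splitting. -/
theorem ring_identity (d a : ℕ → E) (M : ℕ) :
    inner ℝ (d 0 - a 0) (a 0) +
      ∑ i ∈ Finset.range M, inner ℝ ((d (i + 1) - a (i + 1)) - (d i - a i)) (a (i + 1)) =
    -(∑ i ∈ Finset.range M, inner ℝ (a (i + 1) - a i) (d i))
      - 2⁻¹ * (∑ i ∈ Finset.range M, ‖a (i + 1) - a i‖ ^ 2)
      + (inner ℝ (d M) (a M) - 2⁻¹ * ‖a 0‖ ^ 2 - 2⁻¹ * ‖a M‖ ^ 2) := by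
  induction M with
  | zero =>
    simp only [Finset.range_zero, Finset.sum_empty, inner_sub_left, ← real_inner_self_eq_norm_sq]
    ring
  | succ M ih =>
    rw [Finset.sum_range_succ, ← add_assoc, ih, Finset.sum_range_succ, Finset.sum_range_succ]
    simp only [inner_sub_left, inner_sub_right, ← real_inner_self_eq_norm_sq,
      real_inner_comm (a M) (a (M + 1)), real_inner_comm (d M) (a (M + 1)),
      real_inner_comm (d M) (a M)]
    ring

/-- Closing the ring completes the boundary terms to a square of favourable sign. It is used with
`d` the governing errors and `a` the errors of the iterates; `d M = a 0` is then the convention `zb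
k M = x k 0`. -/
theorem ring_identity_cyclic (d a : ℕ → E) (M : ℕ) (hM : d M = a 0) :
    inner ℝ (d 0 - a 0) (a 0) +
      ∑ i ∈ Finset.range M, inner ℝ ((d (i + 1) - a (i + 1)) - (d i - a i)) (a (i + 1)) =
    -(∑ i ∈ Finset.range M, inner ℝ (a (i + 1) - a i) (d i))
      - 2⁻¹ * (∑ i ∈ Finset.range M, ‖a (i + 1) - a i‖ ^ 2) - 2⁻¹ * ‖a M - a 0‖ ^ 2 := by
  rw [ring_identity, hM, @norm_sub_sq_real _ _ _ (a M) (a 0), real_inner_comm (a M) (a 0)]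
  ring

/-- `y` together with the governing points `w` is a stationary configuration of the ring
splitting for the operators `S 0, …, S M` and the single-valued operators `D 0, …, D (M - 1)`. -/
structure IsStationary (S : ℕ → E → Set E) (D : ℕ → E → E) (M : ℕ) (y : E) (w : ℕ → E) :
    Prop where
  last : w M = y
  zero : w 0 - y ∈ S 0 y
  succ : ∀ i < M, w (i + 1) - w i - D i y ∈ S (i + 1) y

/-- Monotone operators with `Id + S i` surjective, and `b`-cocoercive `D i`. -/
structure IsSplittingData (S : ℕ → E → Set E) (D : ℕ → E → E) (M : ℕ) (b : ℝ) : Prop where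
  mono : ∀ i ≤ M, ∀ x y u v, u ∈ S i x → v ∈ S i y → 0 ≤ (inner ℝ (u - v) (x - y) : ℝ)
  surj : ∀ i ≤ M, ∀ s, ∃ r, s - r ∈ S i r
  coco : ∀ i < M, ∀ x y, b * ‖D i x - D i y‖ ^ 2 ≤ inner ℝ (D i x - D i y) (x - y)

/-- The ring splitting iteration, with the convention `zb k M = x k 0`. -/
structure IsRingIteration (S : ℕ → E → Set E) (D : ℕ → E → E) (M : ℕ) (γ : ℝ)
    (zb x : ℕ → ℕ → E) : Prop where
  last : ∀ k, zb k M = x k 0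
  zero : ∀ k, zb k 0 - x k 0 ∈ S 0 (x k 0)
  succ : ∀ k, ∀ i < M,
    (zb k (i + 1) - x k (i + 1)) - (zb k i - x k i) - D i (x k i) ∈ S (i + 1) (x k (i + 1))
  update : ∀ k, ∀ i < M, zb (k + 1) i = zb k i + γ • (x k (i + 1) - x k i)

variable {S : ℕ → E → Set E} {D : ℕ → E → E} {M : ℕ} {b γ : ℝ} {zb x : ℕ → ℕ → E}

/-- The form on the right has determinant `2b(1-γ) - 1 > 0`. Taking `δ` as determinant over trace
leaves determinant `δ ^ 2` after subtracting `δ` times the identity, so completing the square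
suffices. -/
theorem exists_quadratic_bound (hb : 0 < b) (hγ1 : γ < 1) (hbγ : 1 < 2 * b * (1 - γ)) :
    ∃ δ > 0, ∀ c e : ℝ,
      δ * (c ^ 2 + e ^ 2) ≤ 2 * b * c ^ 2 - 2 * (c * e) + (1 - γ) * e ^ 2 := by
  have hs : 0 < 2 * b + (1 - γ) := by linarith
  set δ := (2 * b * (1 - γ) - 1) / (2 * b + (1 - γ)) with hδ
  have h1 : δ * (2 * b + (1 - γ)) = 2 * b * (1 - γ) - 1 := by rw [hδ]; field_simp
  have hδ0 : 0 < δ := div_pos (by linarith) hs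
  have h2 : δ < 2 * b := by
    rw [hδ, div_lt_iff₀ hs]; nlinarith
  refine ⟨δ, hδ0, fun c e => ?_⟩
  have h3 : (2 * b - δ) * (1 - γ - δ) = 1 + δ ^ 2 := by linear_combination -h1
  have h4 : 0 ≤ (2 * b - δ) *
      ((2 * b - δ) * c ^ 2 - 2 * (c * e) + (1 - γ - δ) * e ^ 2) := by
    have : (2 * b - δ) * ((2 * b - δ) * c ^ 2 - 2 * (c * e) + (1 - γ - δ) * e ^ 2)
        = ((2 * b - δ) * c - e) ^ 2 + δ ^ 2 * e ^ 2 := by linear_combination e ^ 2 * h3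
    rw [this]; positivity
  have h5 := nonneg_of_mul_nonneg_right h4 (by linarith : 0 < 2 * b - δ)
  linarith

/-- The basic monotonicity estimate of an iterate against a stationary configuration. -/
theorem sum_inner_le (hd : IsSplittingData S D M b) (hx : IsRingIteration S D M γ zb x)
    {y : E} {w : ℕ → E} (hw : IsStationary S D M y w) (k : ℕ) :
    ∑ i ∈ Finset.range M, (2 * inner ℝ (x k (i + 1) - x k i) (zb k i - w i)
      + ‖x k (i + 1) - x k i‖ ^ 2 + 2 * b * ‖D i (x k i) - D i y‖ ^ 2
      - 2 * (‖D i (x k i) - D i y‖ * ‖x k (i + 1) - x k i‖)) ≤ 0 := by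
  have hid := ring_identity_cyclic (fun i => zb k i - w i) (fun i => x k i - y) M
    (by simp only [hx.last, hw.last])
  simp only [sub_sub_sub_cancel_right] at hid
  have h0 : 0 ≤ inner ℝ (zb k 0 - w 0 - (x k 0 - y)) (x k 0 - y) := by
    have := hd.mono 0 (Nat.zero_le _) _ _ _ _ (hx.zero k) hw.zero
    convert this using 2
    abel
  have h1 : ∀ i ∈ Finset.range M,
      inner ℝ (D i (x k i) - D i y) (x k (i + 1) - y) ≤
      inner ℝ (zb k (i + 1) - w (i + 1) - (x k (i + 1) - y) - (zb k i - w i - (x k i - y)))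
        (x k (i + 1) - y) := by
    intro i hi
    have hi := Finset.mem_range.1 hi
    have := hd.mono (i + 1) hi _ _ _ _ (hx.succ k i hi) (hw.succ i hi)
    rw [← sub_nonneg, ← inner_sub_left]
    convert this using 2
    abel
  -- The forward term is evaluated at `x k i` but paired with the next iterate; the mismatch costs
  -- the product of norms.
  have h2 : ∀ i ∈ Finset.range M,
      b * ‖D i (x k i) - D i y‖ ^ 2 - ‖D i (x k i) - D i y‖ * ‖x k (i + 1) - x k i‖ ≤
      inner ℝ (D i (x k i) - D i y) (x k (i + 1) - y) := by
    intro i hi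
    have h3 := hd.coco i (Finset.mem_range.1 hi) (x k i) y
    have h4 := neg_le_of_abs_le
      (abs_real_inner_le_norm (D i (x k i) - D i y) (x k (i + 1) - x k i))
    have h5 : x k (i + 1) - y = (x k i - y) + (x k (i + 1) - x k i) := by abel
    rw [h5, inner_add_right]
    linarith
  have h3 := (Finset.sum_le_sum h2).trans (Finset.sum_le_sum h1)
  simp only [Finset.sum_add_distrib, Finset.sum_sub_distrib, ← Finset.mul_sum, mul_assoc] at h3 ⊢
  nlinarith [sq_nonneg ‖x k M - x k 0‖]

/-- Fejér monotonicity with respect to stationary configurations. -/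
theorem exists_fejer (hd : IsSplittingData S D M b) (hx : IsRingIteration S D M γ zb x)
    (hb : 0 < b) (hγ : 0 < γ) (hγ1 : γ < 1) (hbγ : 1 < 2 * b * (1 - γ)) :
    ∃ δ > 0, ∀ y w, IsStationary S D M y w → ∀ k,
      ∑ i ∈ Finset.range M, ‖zb (k + 1) i - w i‖ ^ 2
        + δ * ∑ i ∈ Finset.range M, (‖D i (x k i) - D i y‖ ^ 2 + ‖x k (i + 1) - x k i‖ ^ 2) ≤
      ∑ i ∈ Finset.range M, ‖zb k i - w i‖ ^ 2 := by
  obtain ⟨δ, hδ, hq⟩ := exists_quadratic_bound hb hγ1 hbγ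
  refine ⟨γ * δ, mul_pos hγ hδ, fun y w hw k => ?_⟩
  have h1 := sum_inner_le hd hx hw k
  have h2 : ∀ i ∈ Finset.range M, ‖zb (k + 1) i - w i‖ ^ 2
      + γ * δ * (‖D i (x k i) - D i y‖ ^ 2 + ‖x k (i + 1) - x k i‖ ^ 2) - ‖zb k i - w i‖ ^ 2 ≤
      γ * (2 * inner ℝ (x k (i + 1) - x k i) (zb k i - w i)
      + ‖x k (i + 1) - x k i‖ ^ 2 + 2 * b * ‖D i (x k i) - D i y‖ ^ 2
      - 2 * (‖D i (x k i) - D i y‖ * ‖x k (i + 1) - x k i‖)) := by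
    intro i hi
    have h3 : zb (k + 1) i - w i = (zb k i - w i) + γ • (x k (i + 1) - x k i) := by
      rw [hx.update k i (Finset.mem_range.1 hi)]; abel
    rw [h3, norm_add_sq_real, norm_smul, inner_smul_right, mul_pow, Real.norm_eq_abs, sq_abs,
      real_inner_comm]
    nlinarith [mul_le_mul_of_nonneg_left
      (hq ‖D i (x k i) - D i y‖ ‖x k (i + 1) - x k i‖) hγ.le]
  have h3 := Finset.sum_le_sum h2
  rw [← Finset.mul_sum] at h3
  have h4 := h3.trans (mul_nonpos_of_nonneg_of_nonpos hγ.le h1)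
  simp only [Finset.sum_sub_distrib, Finset.sum_add_distrib, ← Finset.mul_sum] at h4 ⊢
  linarith

end Splitting

/-! ### Weak convergence of the ring splitting. -/

section Convergence

variable {E : Type*} [NormedAddCommGroup E] [InnerProductSpace ℝ E]
variable {S : ℕ → E → Set E} {D : ℕ → E → E} {M : ℕ} {b γ : ℝ} {zb x : ℕ → ℕ → E}

/-- The consequences of Fejér monotonicity for a fixed stationary configuration. -/
structure IsFejerAt (D : ℕ → E → E) (M : ℕ) (zb x : ℕ → ℕ → E) (y : E) (w : ℕ → E) (R : ℝ) :
    Prop where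
  dist : ∃ l, Tendsto (fun k => ∑ i ∈ Finset.range M, ‖zb k i - w i‖ ^ 2) atTop (𝓝 l)
  step : ∀ i < M, Tendsto (fun k => ‖x k (i + 1) - x k i‖) atTop (𝓝 0)
  coco : ∀ i < M, Tendsto (fun k => ‖D i (x k i) - D i y‖) atTop (𝓝 0)
  bound_zb : ∀ i ≤ M, ∀ k, ‖zb k i - w i‖ ≤ R
  bound_x : ∀ k, ‖x k 0 - y‖ ≤ R

theorem exists_isFejerAt (hM : 0 < M) (hd : IsSplittingData S D M b)
    (hx : IsRingIteration S D M γ zb x)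
    (hb : 0 < b) (hγ : 0 < γ) (hγ1 : γ < 1) (hbγ : 1 < 2 * b * (1 - γ))
    {y : E} {w : ℕ → E} (hw : IsStationary S D M y w) :
    ∃ R, IsFejerAt D M zb x y w R := by
  obtain ⟨δ, hδ, hF⟩ := exists_fejer hd hx hb hγ hγ1 hbγ
  replace hF := hF y w hw
  set V : ℕ → ℝ := fun k => ∑ i ∈ Finset.range M, ‖zb k i - w i‖ ^ 2 with hV
  set G : ℕ → ℝ := fun k => ∑ i ∈ Finset.range M,
    (‖D i (x k i) - D i y‖ ^ 2 + ‖x k (i + 1) - x k i‖ ^ 2) with hG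
  have hF' : ∀ k, V (k + 1) + δ * G k ≤ V k := hF
  have hV0 : ∀ k, 0 ≤ V k := fun k => Finset.sum_nonneg fun i _ => by positivity
  have hG0 : ∀ k, 0 ≤ G k := fun k => Finset.sum_nonneg fun i _ => by positivity
  have hanti : Antitone V := antitone_nat_of_succ_le fun k => by
    have := hF' k; have := mul_nonneg hδ.le (hG0 k); linarith
  obtain ⟨l, hl⟩ : ∃ l, Tendsto V atTop (𝓝 l) :=
    ⟨_, tendsto_atTop_ciInf hanti ⟨0, by rintro _ ⟨k, rfl⟩; exact hV0 k⟩⟩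
  have hGlim : Tendsto G atTop (𝓝 0) := by
    have h1 : Tendsto (fun k => δ⁻¹ * (V k - V (k + 1))) atTop (𝓝 0) := by
      simpa using (hl.sub (hl.comp (tendsto_add_atTop_nat 1))).const_mul δ⁻¹
    refine squeeze_zero hG0 (fun k => ?_) h1
    rw [← div_eq_inv_mul, le_div_iff₀ hδ]
    have := hF' k; linarith
  have hterm : ∀ u : ℕ → ℝ, (∀ k, 0 ≤ u k) → (∀ k, u k ^ 2 ≤ G k) →
      Tendsto u atTop (𝓝 0) := by
    intro u hu h
    have h1 : Tendsto (fun k => √(G k)) atTop (𝓝 0) := by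
      have := (Real.continuous_sqrt.tendsto 0).comp hGlim
      rwa [Real.sqrt_zero] at this
    exact squeeze_zero hu (fun k => Real.le_sqrt_of_sq_le (h k)) h1
  have hle : ∀ i < M, ∀ k,
      ‖D i (x k i) - D i y‖ ^ 2 + ‖x k (i + 1) - x k i‖ ^ 2 ≤ G k := fun i hi k =>
    Finset.single_le_sum
      (f := fun i => ‖D i (x k i) - D i y‖ ^ 2 + ‖x k (i + 1) - x k i‖ ^ 2)
      (fun i _ => by positivity) (Finset.mem_range.2 hi)
  have hzb : ∀ i < M, ∀ k, ‖zb k i - w i‖ ≤ √(V 0) := fun i hi k =>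
    Real.le_sqrt_of_sq_le ((Finset.single_le_sum (f := fun i => ‖zb k i - w i‖ ^ 2)
      (fun i _ => by positivity) (Finset.mem_range.2 hi)).trans (hanti (Nat.zero_le k)))
  -- The resolvent of `S 0` is nonexpansive, so the first iterate inherits the bound on `zb k 0`.
  have hx0 : ∀ k, ‖x k 0 - y‖ ≤ √(V 0) := fun k => by
    refine le_trans ?_ (hzb 0 hM k)
    have h1 := hd.mono 0 (Nat.zero_le _) _ _ _ _ (hx.zero k) hw.zero
    have h2 : zb k 0 - x k 0 - (w 0 - y) = (zb k 0 - w 0) - (x k 0 - y) := by abel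
    rw [h2, inner_sub_left, real_inner_self_eq_norm_sq] at h1
    have h3 := real_inner_le_norm (zb k 0 - w 0) (x k 0 - y)
    by_contra! h4
    nlinarith [norm_nonneg (x k 0 - y), norm_nonneg (zb k 0 - w 0)]
  refine ⟨√(V 0), ⟨l, hl⟩, fun i hi => hterm _ (fun _ => norm_nonneg _) fun k => ?_,
    fun i hi => hterm _ (fun _ => norm_nonneg _) fun k => ?_, fun i hi k => ?_, hx0⟩
  · have := hle i hi k; nlinarith [sq_nonneg ‖D i (x k i) - D i y‖]
  · have := hle i hi k; nlinarith [sq_nonneg ‖x k (i + 1) - x k i‖]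
  · rcases hi.lt_or_eq with h | rfl
    · exact hzb i h k
    · rw [hx.last, hw.last]; exact hx0 k

/-- Weak limits of a bounded ring iteration along an ultrafilter. -/
structure IsWeakLimit (U : Ultrafilter ℕ) (M : ℕ) (zb x : ℕ → ℕ → E) (y : E) (w : ℕ → E) :
    Prop where
  zb : ∀ i ≤ M, ∀ v, Tendsto (fun k => inner ℝ (zb k i) v) U (𝓝 (inner ℝ (w i) v))
  x : ∀ i ≤ M, ∀ v, Tendsto (fun k => inner ℝ (x k i) v) U (𝓝 (inner ℝ y v))

theorem tendsto_norm_sub_zero {F : Type*} [SeminormedAddCommGroup F] {x : ℕ → ℕ → F}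
    {l : Filter ℕ}
    (hs : ∀ i < M, Tendsto (fun k => ‖x k (i + 1) - x k i‖) l (𝓝 0)) :
    ∀ i ≤ M, Tendsto (fun k => ‖x k i - x k 0‖) l (𝓝 0) := by
  intro i
  induction i with
  | zero => intro _; simpa using tendsto_const_nhds
  | succ i ih =>
    intro hi
    refine squeeze_zero (fun _ => norm_nonneg _) (fun k => ?_)
      (by simpa using (hs i hi).add (ih (by omega)))
    exact norm_sub_le_norm_sub_add_norm_sub _ _ _

/-- All iterates share one weak limit because the steps vanish; it equals `w M` because `zb k M = x
k 0`. -/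
theorem exists_isWeakLimit [CompleteSpace E] (hx : IsRingIteration S D M γ zb x)
    {y₀ : E} {w₀ : ℕ → E} {R : ℝ} (hF : IsFejerAt D M zb x y₀ w₀ R)
    (U : Ultrafilter ℕ) (hU : (U : Filter ℕ) ≤ atTop) :
    ∃ w, IsWeakLimit U M zb x (w M) w := by
  have h1 : ∀ i, ∃ z, i ≤ M →
      ∀ v, Tendsto (fun k => inner ℝ (zb k i) v) U (𝓝 (inner ℝ z v)) := by
    intro i
    by_cases hi : i ≤ M
    · obtain ⟨z, hz⟩ := exists_weak_limit U (fun k => zb k i) (R + ‖w₀ i‖) fun k => by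
        have h2 : zb k i = (zb k i - w₀ i) + w₀ i := by abel
        rw [h2]
        exact (norm_add_le _ _).trans (by gcongr; exact hF.bound_zb i hi k)
      exact ⟨z, fun _ => hz⟩
    · exact ⟨0, fun h => absurd h hi⟩
  choose w hw using h1
  refine ⟨w, hw, fun i hi v => ?_⟩
  have h2 := tendsto_norm_sub_zero (fun i hi => (hF.step i hi).mono_left hU) i hi
  have h3 := (tendsto_inner_zero_of_bounded (v := fun _ => v) ‖v‖ h2 (fun _ => le_rfl)).add
    (hw M le_rfl v)
  simp only [hx.last, inner_sub_left, sub_add_cancel, zero_add] at h3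
  exact h3

/-- Weak limits of the iteration along ultrafilters are stationary. -/
theorem IsWeakLimit.isStationary (hd : IsSplittingData S D M b)
    (hx : IsRingIteration S D M γ zb x) (hb : 0 < b)
    {y₀ : E} {w₀ : ℕ → E} {R : ℝ} (hF : IsFejerAt D M zb x y₀ w₀ R)
    {U : Ultrafilter ℕ} (hU : (U : Filter ℕ) ≤ atTop) {w : ℕ → E}
    (hl : IsWeakLimit U M zb x (w M) w) : IsStationary S D M (w M) w := by
  set y := w M with hy
  have hstep : ∀ i < M, Tendsto (fun k => ‖x k (i + 1) - x k i‖) U (𝓝 0) :=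
    fun i hi => (hF.step i hi).mono_left hU
  have hsub := tendsto_norm_sub_zero hstep
  have hbx0 : ∀ k, ‖x k 0 - y‖ ≤ R + ‖y₀ - y‖ := fun k => by
    have h2 : x k 0 - y = (x k 0 - y₀) + (y₀ - y) := by abel
    rw [h2]
    exact (norm_add_le _ _).trans (by gcongr; exact hF.bound_x k)
  have hbz : ∀ i ≤ M, ∀ k, ‖zb k i - w i‖ ≤ R + ‖w₀ i - w i‖ := fun i hi k => by
    have h2 : zb k i - w i = (zb k i - w₀ i) + (w₀ i - w i) := by abel
    rw [h2]
    exact (norm_add_le _ _).trans (by gcongr; exact hF.bound_zb i hi k)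
  -- a null sequence paired with the iterates is null
  have hnull : ∀ u : ℕ → E, Tendsto (fun k => ‖u k‖) U (𝓝 0) → ∀ i ≤ M,
      Tendsto (fun k => inner ℝ (u k) (x k i - y)) U (𝓝 0) := by
    intro u hu i hi
    have h1 := tendsto_inner_zero_of_bounded _ hu hbx0
    have h2 : Tendsto (fun k => inner ℝ (u k) (x k i - x k 0)) U (𝓝 0) :=
      squeeze_zero_norm (fun k => norm_inner_le_norm _ _) (by simpa using hu.mul (hsub i hi))
    refine (by simpa using h2.add h1 : Tendsto _ _ _).congr fun k => ?_
    rw [← inner_add_right, sub_add_sub_cancel]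
  have hweakx : ∀ i ≤ M, ∀ v, Tendsto (fun k => inner ℝ v (x k i - y)) U (𝓝 0) := by
    intro i hi v
    have h1 := (hl.x i hi v).sub_const (inner ℝ y v)
    rw [sub_self] at h1
    refine h1.congr fun k => ?_
    rw [← inner_sub_left, real_inner_comm]
  -- the single-valued operators converge to their value at the weak limit
  have hD : ∀ i < M, D i y₀ = D i y := by
    intro i hi
    have hu : Tendsto (fun k => ‖D i (x k i) - D i y₀‖) U (𝓝 0) := (hF.coco i hi).mono_left hU
    -- `D i (x k i)` converges strongly to `D i y₀` while `x k i` converges weakly to `y`, so the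
    -- right side of cocoercivity between `x k i` and `y` tends to zero, forcing `D i y₀ = D i y`.
    have h1 := (hnull _ hu i hi.le).add (hweakx i hi.le (D i y₀ - D i y))
    have h2 : Tendsto (fun k => D i (x k i) - D i y) U (𝓝 (D i y₀ - D i y)) := by
      have := (tendsto_zero_iff_norm_tendsto_zero.2 hu).add_const (D i y₀ - D i y)
      simpa using this
    have h3 := le_of_tendsto_of_tendsto ((h2.norm.pow 2).const_mul b) h1
      (Eventually.of_forall fun k => by
        have := hd.coco i hi (x k i) y
        simp only [← inner_add_left, sub_add_sub_cancel]
        exact this)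
    rw [add_zero] at h3
    have h4 : ‖D i y₀ - D i y‖ ^ 2 ≤ 0 := nonpos_of_mul_nonpos_right h3 hb
    have h5 : ‖D i y₀ - D i y‖ = 0 := by nlinarith [norm_nonneg (D i y₀ - D i y)]
    exact sub_eq_zero.1 (norm_eq_zero.1 h5)
  have hDlim : ∀ i < M, Tendsto (fun k => ‖D i (x k i) - D i y‖) U (𝓝 0) := by
    intro i hi; rw [← hD i hi]; exact (hF.coco i hi).mono_left hU
  -- residuals `u` of the iteration and `s` of the limit
  let u : ℕ → ℕ → E := fun k i => Nat.casesOn i (zb k 0 - x k 0)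
    fun i => (zb k (i + 1) - x k (i + 1)) - (zb k i - x k i) - D i (x k i)
  let s : ℕ → E := fun i => Nat.casesOn i (w 0 - y) fun i => w (i + 1) - w i - D i y
  have hus0 : ∀ k, u k 0 - s 0 = (zb k 0 - x k 0) - (w 0 - y) := fun _ => rfl
  have hus : ∀ k i, u k (i + 1) - s (i + 1) =
      ((zb k (i + 1) - x k (i + 1)) - (zb k i - x k i) - D i (x k i))
        - (w (i + 1) - w i - D i y) := fun _ _ => rfl
  have hu : ∀ k, ∀ i ≤ M, u k i ∈ S i (x k i) := by
    rintro k (_ | i) hi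
    · exact hx.zero k
    · exact hx.succ k i hi
  -- The ring identity rewrites this sum so that every term contains a strongly null factor against
  -- a bounded one.
  have hsum : Tendsto (fun k => ∑ i ∈ Finset.range (M + 1), inner ℝ (u k i - s i) (x k i - y)) U
      (𝓝 0) := by
    have hid := fun k => ring_identity_cyclic (fun i => zb k i - w i) (fun i => x k i - y) M
      (by simp only [hx.last, hy])
    simp only [sub_sub_sub_cancel_right] at hid
    have h1 : ∀ k, ∑ i ∈ Finset.range (M + 1), inner ℝ (u k i - s i) (x k i - y) =
        -(∑ i ∈ Finset.range M, inner ℝ (x k (i + 1) - x k i) (zb k i - w i))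
        - 2⁻¹ * (∑ i ∈ Finset.range M, ‖x k (i + 1) - x k i‖ ^ 2) - 2⁻¹ * ‖x k M - x k 0‖ ^ 2
        - ∑ i ∈ Finset.range M, inner ℝ (D i (x k i) - D i y) (x k (i + 1) - y) := by
      intro k
      rw [← hid k, Finset.sum_range_succ', add_sub_assoc, ← Finset.sum_sub_distrib, add_comm]
      congr 1
      · rw [hus0]; congr 1; abel
      · refine Finset.sum_congr rfl fun i _ => ?_
        rw [← inner_sub_left, hus]
        congr 1; abel
    simp only [h1]
    have e1 : Tendsto (fun k => ∑ i ∈ Finset.range M,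
        inner ℝ (x k (i + 1) - x k i) (zb k i - w i)) U (𝓝 0) := by
      rw [← Finset.sum_const_zero (ι := ℕ) (s := Finset.range M)]
      exact tendsto_finsetSum _ fun i hi => tendsto_inner_zero_of_bounded _
        (hstep i (Finset.mem_range.1 hi)) (hbz i (Finset.mem_range.1 hi).le)
    have e2 : Tendsto (fun k => ∑ i ∈ Finset.range M, ‖x k (i + 1) - x k i‖ ^ 2) U (𝓝 0) := by
      rw [← Finset.sum_const_zero (ι := ℕ) (s := Finset.range M)]
      exact tendsto_finsetSum _ fun i hi => by
        simpa using (hstep i (Finset.mem_range.1 hi)).pow 2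
    have e3 : Tendsto (fun k => ∑ i ∈ Finset.range M,
        inner ℝ (D i (x k i) - D i y) (x k (i + 1) - y)) U (𝓝 0) := by
      rw [← Finset.sum_const_zero (ι := ℕ) (s := Finset.range M)]
      exact tendsto_finsetSum _ fun i hi =>
        hnull _ (hDlim i (Finset.mem_range.1 hi)) _ (Finset.mem_range.1 hi)
    simpa using ((e1.neg.sub (e2.const_mul 2⁻¹)).sub
      (((hsub M le_rfl).pow 2).const_mul 2⁻¹)).sub e3
  have hweaku : ∀ i ≤ M, ∀ v, Tendsto (fun k => inner ℝ (u k i - s i) v) U (𝓝 0) := by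
    have hx' : ∀ i ≤ M, ∀ v, Tendsto (fun k => inner ℝ (x k i - y) v) U (𝓝 0) :=
      fun i hi v => (hweakx i hi v).congr fun k => real_inner_comm _ _
    have hz' : ∀ i ≤ M, ∀ v, Tendsto (fun k => inner ℝ (zb k i - w i) v) U (𝓝 0) := by
      intro i hi v
      have h1 := (hl.zb i hi v).sub_const (inner ℝ (w i) v)
      rw [sub_self] at h1
      exact h1.congr fun k => (inner_sub_left _ _ _).symm
    rintro (_ | i) hi v
    · refine (by simpa using (hz' 0 hi v).sub (hx' 0 hi v) : Tendsto _ _ _).congr fun k => ?_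
      rw [← inner_sub_left, hus0]; congr 1; abel
    · have h1 := tendsto_inner_zero_of_bounded (v := fun _ => v) ‖v‖ (hDlim i hi)
        (fun _ => le_rfl)
      have h2 := (((hz' (i + 1) hi v).sub (hx' (i + 1) hi v)).sub
        ((hz' i (by omega) v).sub (hx' i (by omega) v))).sub h1
      rw [show (0 : ℝ) - 0 - (0 - 0) - 0 = 0 by norm_num] at h2
      refine h2.congr fun k => ?_
      rw [hus]; simp only [← inner_sub_left]; congr 1; abel
  -- Minty-type test points: `r i` solves the resolvent equation of `S i` at `s i + y`. Monotonicity
  -- against the iterates gives `-∑ ‖y - r i‖ ^ 2 ≥ 0` in the limit, so `r i = y` and `s i ∈ S i y`.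
  have hr : ∀ i, ∃ r, i ≤ M → s i + y - r ∈ S i r := by
    intro i
    by_cases hi : i ≤ M
    · obtain ⟨r, hr⟩ := hd.surj i hi (s i + y)
      exact ⟨r, fun _ => hr⟩
    · exact ⟨0, fun h => absurd h hi⟩
  choose r hr using hr
  have hlim : Tendsto (fun k => ∑ i ∈ Finset.range (M + 1),
      inner ℝ (u k i - (s i + y - r i)) (x k i - r i)) U
      (𝓝 (∑ i ∈ Finset.range (M + 1), -‖y - r i‖ ^ 2)) := by
    have h1 : Tendsto (fun k => ∑ i ∈ Finset.range (M + 1), (inner ℝ (u k i - s i) (y - r i)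
        - inner ℝ (y - r i) (x k i - y) - ‖y - r i‖ ^ 2)) U
        (𝓝 (∑ i ∈ Finset.range (M + 1), -‖y - r i‖ ^ 2)) := by
      refine tendsto_finsetSum _ fun i hi => ?_
      have hi : i ≤ M := Nat.lt_succ_iff.1 (Finset.mem_range.1 hi)
      simpa using ((hweaku i hi (y - r i)).sub (hweakx i hi (y - r i))).sub_const (‖y - r i‖ ^ 2)
    refine (by simpa only [zero_add] using hsum.add h1 : Tendsto _ _ _).congr fun k => ?_
    rw [← Finset.sum_add_distrib]
    refine Finset.sum_congr rfl fun i _ => ?_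
    have h2 : u k i - (s i + y - r i) = (u k i - s i) - (y - r i) := by abel
    have h3 : x k i - r i = (x k i - y) + (y - r i) := by abel
    rw [h2, h3, inner_sub_left (u k i - s i), inner_add_right, inner_add_right,
      real_inner_self_eq_norm_sq]
    ring
  have hnn : 0 ≤ ∑ i ∈ Finset.range (M + 1), -‖y - r i‖ ^ 2 :=
    ge_of_tendsto' hlim fun k => Finset.sum_nonneg fun i hi => by
      have hi : i ≤ M := Nat.lt_succ_iff.1 (Finset.mem_range.1 hi)
      exact hd.mono i hi _ _ _ _ (hu k i hi) (hr i hi)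
  rw [Finset.sum_neg_distrib, neg_nonneg] at hnn
  have hzero := (Finset.sum_eq_zero_iff_of_nonneg (fun i _ => by positivity)).1
    (le_antisymm hnn (Finset.sum_nonneg fun i _ => by positivity))
  have hs : ∀ i ≤ M, s i ∈ S i y := by
    intro i hi
    have h1 := hzero i (Finset.mem_range.2 (Nat.lt_succ_iff.2 hi))
    have h2 : y = r i := by simpa [sub_eq_zero] using h1
    have h3 := hr i hi
    rw [← h2, add_sub_cancel_right] at h3
    exact h3
  exact ⟨rfl, hs 0 (Nat.zero_le _), fun i hi => hs (i + 1) hi⟩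

/-- Weak convergence of the ring splitting. -/
theorem exists_weak_limit_isStationary [CompleteSpace E] (hM : 0 < M)
    (hd : IsSplittingData S D M b) (hx : IsRingIteration S D M γ zb x)
    (hb : 0 < b) (hγ : 0 < γ) (hγ1 : γ < 1) (hbγ : 1 < 2 * b * (1 - γ))
    (hex : ∃ y w, IsStationary S D M y w) :
    ∃ y w, IsStationary S D M y w ∧
      ∀ v, Tendsto (fun k => inner ℝ (x k 0) v) atTop (𝓝 (inner ℝ y v)) := by
  obtain ⟨y₀, w₀, hw₀⟩ := hex
  obtain ⟨R, hF⟩ := exists_isFejerAt hM hd hx hb hγ hγ1 hbγ hw₀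
  obtain ⟨w, hw⟩ := exists_isWeakLimit hx hF (Ultrafilter.of atTop) (Ultrafilter.of_le _)
  have hst := hw.isStationary hd hx hb hF (Ultrafilter.of_le _)
  refine ⟨w M, w, hst, fun v => (tendsto_iff_ultrafilter _ _ _).2 fun U hU => ?_⟩
  obtain ⟨w', hw'⟩ := exists_isWeakLimit hx hF U hU
  have hst' := hw'.isStationary hd hx hb hF hU
  suffices h : w' M = w M by rw [← h]; exact hw'.x 0 (Nat.zero_le _) v
  obtain ⟨_, hF1⟩ := exists_isFejerAt hM hd hx hb hγ hγ1 hbγ hst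
  obtain ⟨_, hF2⟩ := exists_isFejerAt hM hd hx hb hγ hγ1 hbγ hst'
  obtain ⟨l₁, hl₁⟩ := hF1.dist
  obtain ⟨l₂, hl₂⟩ := hF2.dist
  have hdiff := hl₁.sub hl₂
  -- Opial's argument: the difference of two squared distances is affine in the iterate, so it
  -- passes to weak limits. Its limit is the same along both ultrafilters, yet it is `-∑ ‖w i - w'
  -- i‖ ^ 2` at `w` and the opposite at `w'`.
  have hlim : ∀ (V : Ultrafilter ℕ) (t : ℕ → E), IsWeakLimit V M zb x (t M) t →
      Tendsto (fun k => ∑ i ∈ Finset.range M, ‖zb k i - w i‖ ^ 2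
        - ∑ i ∈ Finset.range M, ‖zb k i - w' i‖ ^ 2) V
      (𝓝 (∑ i ∈ Finset.range M, (‖t i - w i‖ ^ 2 - ‖t i - w' i‖ ^ 2))) := by
    intro V t ht
    have h1 : ∀ a b c : E, ‖a - b‖ ^ 2 - ‖a - c‖ ^ 2
        = 2 * inner ℝ a (c - b) + (‖b‖ ^ 2 - ‖c‖ ^ 2) := fun a b c => by
      rw [norm_sub_sq_real, norm_sub_sq_real, inner_sub_right]; ring
    simp only [← Finset.sum_sub_distrib, h1]
    exact tendsto_finsetSum _ fun i hi =>
      ((ht.zb i (Finset.mem_range.1 hi).le _).const_mul 2).add_const _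
  have e1 := tendsto_nhds_unique (hlim _ w hw) (hdiff.mono_left (Ultrafilter.of_le _))
  have e2 := tendsto_nhds_unique (hlim _ w' hw') (hdiff.mono_left hU)
  have e3 : ∑ i ∈ Finset.range M, (‖w i - w' i‖ ^ 2 + ‖w' i - w i‖ ^ 2) = 0 := by
    rw [← e2] at e1
    simp only [sub_self, norm_zero, Finset.sum_sub_distrib, Finset.sum_add_distrib] at e1 ⊢
    norm_num at e1
    linarith
  have e4 := (Finset.sum_eq_zero_iff_of_nonneg (fun i _ => by positivity)).1 e3 0
    (Finset.mem_range.2 hM)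
  have e5 : w 0 = w' 0 := by
    have : ‖w 0 - w' 0‖ ^ 2 = 0 := by nlinarith [sq_nonneg ‖w 0 - w' 0‖, sq_nonneg ‖w' 0 - w 0‖]
    simpa [sub_eq_zero] using this
  -- The distances only involve indices below `M`; monotonicity of `S 0` at the common governing
  -- point `w 0 = w' 0` identifies `w M` with `w' M`.
  have h1 := hd.mono 0 (Nat.zero_le _) _ _ _ _ hst.zero hst'.zero
  rw [e5, sub_sub_sub_cancel_left, ← neg_sub (w M) (w' M), inner_neg_left,
    real_inner_self_eq_norm_sq] at h1
  have h2 : ‖w M - w' M‖ = 0 := by nlinarith [norm_nonneg (w M - w' M)]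
  exact (sub_eq_zero.1 (norm_eq_zero.1 h2)).symm

end Convergence

/-! ### Proximal points, subgradients and cocoercive gradients. -/

section ConvexAnalysis

variable {E : Type*} [NormedAddCommGroup E] [InnerProductSpace ℝ E] [CompleteSpace E]

/-- The proximal problem of a nonnegative convex lower semicontinuous function has a solution. -/
theorem exists_isMin_half_sq_add {φ : E → ℝ} (hc : ConvexOn ℝ univ φ)
    (hl : LowerSemicontinuous φ) (h0 : ∀ x, 0 ≤ φ x) (u : E) :
    ∃ x, ∀ y, 2⁻¹ * ‖x - u‖ ^ 2 + φ x ≤ 2⁻¹ * ‖y - u‖ ^ 2 + φ y := by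
  set F : E → ℝ := fun x => 2⁻¹ * ‖x - u‖ ^ 2 + φ x with hF
  have hbdd : BddBelow (range F) := ⟨0, by
    rintro _ ⟨x, rfl⟩
    exact add_nonneg (by positivity) (h0 x)⟩
  set m := ⨅ x, F x with hm
  have hmle : ∀ x, m ≤ F x := fun x => ciInf_le hbdd x
  -- Strong convexity, by the parallelogram law at the midpoint, makes minimising sequences Cauchy.
  have hmid : ∀ x y, ‖x - y‖ ^ 2 ≤ 4 * (F x + F y - 2 * m) := by
    intro x y
    have h1 := hmle ((2⁻¹ : ℝ) • x + (2⁻¹ : ℝ) • y)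
    have h2 := hc.2 (mem_univ x) (mem_univ y) (by norm_num : (0 : ℝ) ≤ 2⁻¹)
      (by norm_num : (0 : ℝ) ≤ 2⁻¹) (by norm_num)
    simp only [smul_eq_mul] at h2
    have h3 : (2⁻¹ : ℝ) • x + (2⁻¹ : ℝ) • y - u = (2⁻¹ : ℝ) • ((x - u) + (y - u)) := by module
    have h4 : ‖(2⁻¹ : ℝ) • x + (2⁻¹ : ℝ) • y - u‖ ^ 2 = 4⁻¹ * ‖(x - u) + (y - u)‖ ^ 2 := by
      rw [h3, norm_smul, mul_pow]; norm_num
    have h5 := parallelogram_law_with_norm ℝ (x - u) (y - u)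
    rw [sub_sub_sub_cancel_right] at h5
    simp only [hF] at h1 ⊢
    rw [h4] at h1
    nlinarith
  have hex : ∀ n : ℕ, ∃ x, F x < m + 1 / ((n : ℝ) + 1) := fun n =>
    exists_lt_of_ciInf_lt (by rw [← hm]; linarith [Nat.one_div_pos_of_nat (α := ℝ) (n := n)])
  choose x hx using hex
  have hlim0 : Tendsto (fun n : ℕ => 1 / ((n : ℝ) + 1)) atTop (𝓝 0) :=
    tendsto_one_div_add_atTop_nhds_zero_nat
  have hcau : CauchySeq x := by
    refine cauchySeq_of_le_tendsto_0 (fun n : ℕ => √(8 * (1 / ((n : ℝ) + 1))))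
      (fun n k N hn hk => ?_) ?_
    · rw [dist_eq_norm]
      refine Real.le_sqrt_of_sq_le ((hmid _ _).trans ?_)
      have h1 := Nat.one_div_le_one_div (α := ℝ) hn
      have h2 := Nat.one_div_le_one_div (α := ℝ) hk
      linarith [hx n, hx k]
    · have := (Real.continuous_sqrt.tendsto _).comp (hlim0.const_mul 8)
      rwa [mul_zero, Real.sqrt_zero] at this
  obtain ⟨z, hz⟩ := cauchySeq_tendsto_of_complete hcau
  have hFl : LowerSemicontinuous F := by
    refine LowerSemicontinuous.add (Continuous.lowerSemicontinuous ?_) hl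
    fun_prop
  have hFx : Tendsto (fun n => F (x n)) atTop (𝓝 m) :=
    tendsto_of_tendsto_of_tendsto_of_le_of_le tendsto_const_nhds
      (by simpa using hlim0.const_add m) (fun n => hmle _) (fun n => (hx n).le)
  have hzm : F z ≤ m := by
    by_contra! hlt
    obtain ⟨c, hmc, hcz⟩ := exists_between hlt
    have h1 := hz.eventually (hFl z c hcz)
    have h2 := hFx.eventually (gt_mem_nhds hmc)
    obtain ⟨n, h3, h4⟩ := (h1.and h2).exists
    exact lt_asymm h3 h4
  exact ⟨z, fun y => hzm.trans (hmle y)⟩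

/-- A real-valued convex lower semicontinuous function on a Banach space is continuous. -/
theorem continuous_of_convexOn_of_lowerSemicontinuous {F : Type*} [NormedAddCommGroup F]
    [NormedSpace ℝ F] [CompleteSpace F] {f : F → ℝ} (hc : ConvexOn ℝ univ f)
    (hl : LowerSemicontinuous f) : Continuous f := by
  -- By Baire, one of the closed sublevel sets covering the space has interior, so `f` is bounded
  -- above near some point.
  obtain ⟨n, x, hx⟩ := nonempty_interior_of_iUnion_of_closed (f := fun n : ℕ => f ⁻¹' Iic (n : ℝ))
    (fun n => hl.isClosed_preimage _) (by
      refine eq_univ_of_forall fun x => mem_iUnion.2 ?_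
      exact exists_nat_ge (f x))
  rw [← continuousOn_univ]
  have htfae := hc.continuousOn_tfae isOpen_univ ⟨x, mem_univ x⟩
  refine (htfae.out 1 3 : ContinuousOn f univ ↔
    ∃ x₀ ∈ univ, (𝓝 x₀).IsBoundedUnder (· ≤ ·) f).2 ⟨x, mem_univ x, n, ?_⟩
  rw [eventually_map]
  exact mem_interior_iff_mem_nhds.1 hx

/-- A continuous convex function has a subgradient at every point. -/
theorem exists_subgradient {f : E → ℝ} (hc : ConvexOn ℝ univ f) (hcont : Continuous f) (x : E) :
    ∃ a : E, ∀ y, inner ℝ a (y - x) + f x ≤ f y := by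
  have hopen : IsOpen {p : E × ℝ | p.1 ∈ univ ∧ f p.1 < p.2} := by
    simpa using isOpen_lt (hcont.comp continuous_fst) continuous_snd
  obtain ⟨L, hL⟩ := geometric_hahn_banach_open_point hc.convex_strict_epigraph hopen
    (by simp : ((x, f x) : E × ℝ) ∉ {p : E × ℝ | p.1 ∈ univ ∧ f p.1 < p.2})
  set c := L (0, 1) with hcdef
  let l : E →L[ℝ] ℝ := L.comp (ContinuousLinearMap.inl ℝ E ℝ)
  have hsplit : ∀ (y : E) (t : ℝ), L (y, t) = l y + t * c := by
    intro y t
    have : ((y, t) : E × ℝ) = (y, 0) + t • (0, 1) := by simp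
    rw [this, map_add, map_smul, smul_eq_mul]; rfl
  have h1 : ∀ y t, f y < t → l y + t * c < l x + f x * c := fun y t h => by
    rw [← hsplit, ← hsplit]; exact hL _ ⟨mem_univ _, h⟩
  -- The separating hyperplane is not vertical, so dividing by `-c` turns it into the graph of an
  -- affine minorant.
  have hc0 : c < 0 := by have := h1 x (f x + 1) (by linarith); linarith
  have h2 : ∀ y, l y + f y * c ≤ l x + f x * c := by
    intro y
    refine le_of_tendsto (x := 𝓝[>] (f y)) (f := fun t => l y + t * c) ?_
      (by filter_upwards [self_mem_nhdsWithin] with t ht using (h1 y t ht).le)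
    exact (Continuous.tendsto (by fun_prop) (f y)).mono_left nhdsWithin_le_nhds
  refine ⟨(-c)⁻¹ • (InnerProductSpace.toDual ℝ E).symm l, fun y => ?_⟩
  rw [real_inner_smul_left, InnerProductSpace.toDual_symm_apply, map_sub, ← le_sub_iff_add_le,
    inv_mul_le_iff₀ (by linarith)]
  linarith [h2 y]

/-- This is the descent inequality for half the squared positive part, whose derivative `max 0` is
1-Lipschitz. -/
theorem half_sq_max_add_le (a s : ℝ) :
    2⁻¹ * max 0 (a + s) ^ 2 ≤ 2⁻¹ * max 0 a ^ 2 + max 0 a * s + 2⁻¹ * s ^ 2 := by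
  rcases le_total 0 a with h | h <;> rcases le_total 0 (a + s) with h' | h' <;>
    simp only [max_eq_left, max_eq_right, h, h'] <;> nlinarith

/-- The point solving the resolvent equation of the saddle operator of `(x, p) ↦ p * f x`. -/
theorem exists_saddle_resolvent {f : E → ℝ} (hc : ConvexOn ℝ univ f)
    (hl : LowerSemicontinuous f) {lam : ℝ} (hlam : 0 < lam) (u : E) (v : ℝ) :
    ∃ x, ∀ y, inner ℝ (u - x) (y - x) ≤ lam * (max 0 (v + lam * f x) * (f y - f x)) := by
  -- The second component of the resolvent equation forces `p = G x`; the first then says that `u -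
  -- x` is a subgradient of `G ^ 2 / 2`, so `x` is its proximal point at `u`.
  set G : E → ℝ := fun x => max 0 (v + lam * f x) with hG
  have hGc : ConvexOn ℝ univ G :=
    (convexOn_const 0 convex_univ).sup ((convexOn_const v convex_univ).add (hc.smul hlam.le))
  have hGl : LowerSemicontinuous G := by
    have h1 : Continuous fun t : ℝ => max 0 (v + lam * t) := by fun_prop
    refine h1.comp_lowerSemicontinuous hl fun s t hst => ?_
    exact max_le_max le_rfl (by gcongr)
  have hG0 : ∀ x, 0 ≤ G x := fun x => le_max_left _ _
  have hφc : ConvexOn ℝ univ fun x => 2⁻¹ * G x ^ 2 :=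
    (hGc.pow (fun x _ => hG0 x) 2).smul (by norm_num : (0 : ℝ) ≤ 2⁻¹)
  have hφl : LowerSemicontinuous fun x => 2⁻¹ * G x ^ 2 := by
    -- The square is not monotone on `ℝ`; inserting `max 0` makes it so and changes nothing since `G
    -- ≥ 0`.
    have h1 : Continuous fun t : ℝ => 2⁻¹ * (max 0 t) ^ 2 := by fun_prop
    have h2 := h1.comp_lowerSemicontinuous hGl fun s t hst => by
      have := max_le_max (le_refl (0 : ℝ)) hst
      dsimp only
      gcongr
    simpa [Function.comp_def, max_eq_right (hG0 _)] using h2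
  obtain ⟨x, hx⟩ := exists_isMin_half_sq_add hφc hφl (fun x => by positivity) u
  refine ⟨x, fun y => ?_⟩
  set Δ := f y - f x with hΔ
  set K := 2⁻¹ * ‖y - x‖ ^ 2 + 2⁻¹ * (lam * Δ) ^ 2 with hK
  -- First-order optimality along the segment to `y`: `K` collects the terms of order `t ^ 2`, and
  -- `t → 0` follows.
  have h1 : ∀ t ∈ Ioc (0 : ℝ) 1,
      inner ℝ (u - x) (y - x) - lam * (G x * Δ) ≤ t * K := by
    intro t ht
    have h2 := hx (x + t • (y - x))
    have h3 : f (x + t • (y - x)) ≤ f x + t * Δ := by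
      have h4 := hc.2 (mem_univ x) (mem_univ y) (sub_nonneg.2 ht.2) ht.1.le (by ring)
      have h5 : (1 - t) • x + t • y = x + t • (y - x) := by module
      rw [h5] at h4
      simp only [smul_eq_mul] at h4
      rw [hΔ]; linarith
    have h6 : 2⁻¹ * G (x + t • (y - x)) ^ 2 ≤
        2⁻¹ * max 0 ((v + lam * f x) + lam * (t * Δ)) ^ 2 := by
      have : G (x + t • (y - x)) ≤ max 0 ((v + lam * f x) + lam * (t * Δ)) :=
        max_le_max le_rfl (by nlinarith)
      have := hG0 (x + t • (y - x))
      gcongr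
    have h7 := half_sq_max_add_le (v + lam * f x) (lam * (t * Δ))
    have h8 : x + t • (y - x) - u = (x - u) + t • (y - x) := by abel
    rw [h8, norm_add_sq_real, inner_smul_right, norm_smul, mul_pow, Real.norm_eq_abs, sq_abs] at h2
    have h9 : inner ℝ (u - x) (y - x) = -(inner ℝ (x - u) (y - x) : ℝ) := by
      rw [← inner_neg_left, neg_sub]
    have h10 : 0 ≤ t * (t * K - (inner ℝ (u - x) (y - x) - lam * (G x * Δ))) := by
      rw [h9, hK]
      change _ ≤ 2⁻¹ * G x ^ 2 + G x * _ + _ at h7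
      nlinarith
    linarith [nonneg_of_mul_nonneg_right h10 ht.1]
  have h2 : inner ℝ (u - x) (y - x) - lam * (G x * Δ) ≤ 0 := by
    refine ge_of_tendsto (x := 𝓝[>] (0 : ℝ)) (f := fun t => t * K) ?_ ?_
    · have : Tendsto (fun t : ℝ => t * K) (𝓝 0) (𝓝 (0 * K)) :=
        Continuous.tendsto (by fun_prop) 0
      rw [zero_mul] at this
      exact this.mono_left nhdsWithin_le_nhds
    · filter_upwards [Ioc_mem_nhdsGT one_pos] with t ht using h1 t ht
  linarith

theorem hasDerivAt_comp_line {h : E → ℝ} (hd : Differentiable ℝ h) (x v : E) (t : ℝ) :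
    HasDerivAt (fun t : ℝ => h (x + t • v)) (inner ℝ (gradient h (x + t • v)) v) t := by
  have h1 := (hd (x + t • v)).hasGradientAt.hasFDerivAt
  have h2 : HasDerivAt (fun t : ℝ => x + t • v) v t := by
    simpa using ((hasDerivAt_id t).smul_const v).const_add x
  exact h1.comp_hasDerivAt t h2

theorem add_inner_gradient_le {h : E → ℝ} (hc : ConvexOn ℝ univ h) (hd : Differentiable ℝ h)
    (x y : E) : h x + inner ℝ (gradient h x) (y - x) ≤ h y := by
  have h1 := hasDerivAt_comp_line hd x (y - x) 0
  have h2 : ConvexOn ℝ univ fun t : ℝ => h (x + t • (y - x)) := by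
    have := hc.comp_affineMap (AffineMap.lineMap x y : ℝ →ᵃ[ℝ] E)
    refine (by simpa using this : ConvexOn ℝ univ _).congr fun t _ => ?_
    simp [AffineMap.lineMap_apply, add_comm]
  have h3 := h2.le_slope_of_hasDerivAt (mem_univ 0) (mem_univ 1) one_pos h1
  rw [slope_def_field] at h3
  simp only [zero_smul, add_zero, one_smul, add_sub_cancel, sub_zero, div_one] at h3
  linarith

/-- The descent lemma. -/
theorem le_add_inner_gradient {h : E → ℝ} (hd : Differentiable ℝ h) {L : ℝ}
    (hL : ∀ x y, ‖gradient h x - gradient h y‖ ≤ L * ‖x - y‖) (x y : E) :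
    h y ≤ h x + inner ℝ (gradient h x) (y - x) + L / 2 * ‖y - x‖ ^ 2 := by
  set v := y - x with hv
  -- Up to a constant, `g` is `h` on the segment minus its quadratic model; the Lipschitz bound
  -- gives `g' ≤ 0`.
  set g : ℝ → ℝ := fun t => h (x + t • v) - t * inner ℝ (gradient h x) v
    - L / 2 * ‖v‖ ^ 2 * t ^ 2 with hg
  have hder : ∀ t, HasDerivAt g (inner ℝ (gradient h (x + t • v)) v
      - inner ℝ (gradient h x) v - L * ‖v‖ ^ 2 * t) t := by
    intro t
    have h1 := ((hasDerivAt_comp_line hd x v t).sub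
      ((hasDerivAt_id t).mul_const (inner ℝ (gradient h x) v))).sub
      (((hasDerivAt_id t).pow 2).const_mul (L / 2 * ‖v‖ ^ 2))
    refine h1.congr_deriv ?_
    simp; ring
  have hanti : AntitoneOn g (Icc 0 1) := by
    refine antitoneOn_of_deriv_nonpos (convex_Icc 0 1)
      (fun t _ => (hder t).continuousAt.continuousWithinAt)
      (fun t _ => (hder t).differentiableAt.differentiableWithinAt) fun t ht => ?_
    rw [interior_Icc] at ht
    rw [(hder t).deriv, ← inner_sub_left]
    have h1 := real_inner_le_norm (gradient h (x + t • v) - gradient h x) v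
    have h2 := hL (x + t • v) x
    rw [add_sub_cancel_left, norm_smul, Real.norm_of_nonneg ht.1.le] at h2
    nlinarith [norm_nonneg v]
  have h1 := hanti (left_mem_Icc.2 zero_le_one) (right_mem_Icc.2 zero_le_one) zero_le_one
  simp only [hg, one_smul, zero_smul, add_zero, hv, add_sub_cancel] at h1
  linarith

/-- The Baillon–Haddad theorem: the Lipschitz gradient of a convex function is cocoercive. -/
theorem gradient_cocoercive {h : E → ℝ} (hc : ConvexOn ℝ univ h) (hd : Differentiable ℝ h)
    {β : ℝ} (hβ : 0 < β) (hL : ∀ x y, ‖gradient h x - gradient h y‖ ≤ β⁻¹ * ‖x - y‖) (x y : E) :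
    β * ‖gradient h x - gradient h y‖ ^ 2 ≤
      inner ℝ (gradient h x - gradient h y) (x - y) := by
  have key : ∀ x y, β / 2 * ‖gradient h x - gradient h y‖ ^ 2 ≤
      h y - h x - inner ℝ (gradient h x) (y - x) := by
    intro x y
    set g := gradient h y - gradient h x with hg
    -- The point `y - β • g` minimises the descent bound at `y` minus the tangent of `h` at `x`.
    have h1 := add_inner_gradient_le hc hd x (y - β • g)
    have h2 := le_add_inner_gradient hd hL y (y - β • g)
    have h3 : y - β • g - x = (y - x) - β • g := by abel
    have h4 : y - β • g - y = -(β • g) := by abel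
    rw [h3, inner_sub_right, inner_smul_right] at h1
    rw [h4, inner_neg_right, inner_smul_right, norm_neg, norm_smul, mul_pow,
      Real.norm_of_nonneg hβ.le] at h2
    have h5 : (inner ℝ (gradient h y) g : ℝ) = inner ℝ (gradient h x) g + ‖g‖ ^ 2 := by
      rw [← real_inner_self_eq_norm_sq, ← inner_add_left, hg, add_sub_cancel]
    have h6 : β⁻¹ / 2 * (β ^ 2 * ‖g‖ ^ 2) = β / 2 * ‖g‖ ^ 2 := by field_simp
    rw [h5, h6] at h2
    rw [norm_sub_rev, ← hg]
    nlinarith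
  have h1 := key x y
  have h2 := key y x
  rw [norm_sub_rev (gradient h y)] at h2
  have h3 : (inner ℝ (gradient h x - gradient h y) (x - y) : ℝ)
      = -inner ℝ (gradient h x) (y - x) - inner ℝ (gradient h y) (x - y) := by
    rw [← inner_neg_right, neg_sub, inner_sub_left]
  linarith

end ConvexAnalysis

/-! ### Normal cones, resolvents and the conjugate of `phi`. -/

section SetOperators

variable {E : Type*} [NormedAddCommGroup E] [InnerProductSpace ℝ E]

theorem smul_mem_normalCone {s : Set E} {x u : E} {c : ℝ} (hc : 0 ≤ c)
    (hu : u ∈ normalCone s x) : c • u ∈ normalCone s x :=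
  ⟨hu.1, fun y hy => by
    rw [real_inner_smul_left]; exact mul_nonpos_of_nonneg_of_nonpos hc (hu.2 y hy)⟩

theorem normalCone_monotone {s : Set E} {x y u v : E} (hu : u ∈ normalCone s x)
    (hv : v ∈ normalCone s y) : (0 : ℝ) ≤ inner ℝ (u - v) (x - y) := by
  have h1 := hu.2 y hv.1
  have h2 := hv.2 x hu.1
  rw [← neg_sub x y, inner_neg_right] at h1
  rw [inner_sub_left]
  linarith

theorem sub_proj_mem_normalCone [CompleteSpace E] {s : Set E} (hne : s.Nonempty)
    (hcl : IsClosed s) (hcv : Convex ℝ s) (u : E) : u - proj s u ∈ normalCone s (proj s u) := by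
  have hbdd : BddBelow (range fun w : s => ‖u - w‖) := ⟨0, by
    rintro _ ⟨w, rfl⟩; exact norm_nonneg _⟩
  have hex : ∃ y, y ∈ s ∧ ∀ w ∈ s, ‖u - y‖ ≤ ‖u - w‖ := by
    obtain ⟨v, hv, h⟩ := exists_norm_eq_iInf_of_complete_convex hne hcl.isComplete hcv u
    exact ⟨v, hv, fun w hw => by rw [h]; exact ciInf_le hbdd ⟨w, hw⟩⟩
  obtain ⟨h1, h2⟩ : proj s u ∈ s ∧ ∀ w ∈ s, ‖u - proj s u‖ ≤ ‖u - w‖ :=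
    Classical.epsilon_spec hex
  refine ⟨h1, (norm_eq_iInf_iff_real_inner_le_zero hcv h1).1 (le_antisymm ?_ ?_)⟩
  · have : Nonempty s := ⟨⟨_, h1⟩⟩
    exact le_ciInf fun w => h2 w w.2
  · exact ciInf_le hbdd ⟨_, h1⟩

/-- As `resolvent` is an epsilon choice, solvability alone makes it a solution; uniqueness is not
needed. -/
theorem sub_resolvent_mem {lam : ℝ} {A : E → Set E} {u : E} (h : ∃ r, u - r ∈ lam • A r) :
    u - resolvent lam A u ∈ lam • A (resolvent lam A u) := by
  have hiff : ∀ r, u ∈ {r} + lam • A r ↔ u - r ∈ lam • A r := by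
    intro r
    rw [singleton_add, mem_image]
    constructor
    · rintro ⟨w, hw, rfl⟩; rwa [add_sub_cancel_left]
    · exact fun h => ⟨_, h, add_sub_cancel _ _⟩
  obtain ⟨r, hr⟩ := h
  exact (hiff _).1 (Classical.epsilon_spec (p := fun r => u ∈ {r} + lam • A r) ⟨r, (hiff r).2 hr⟩)

theorem smul_monotone {A : E → Set E} {lam : ℝ} (hlam : 0 ≤ lam)
    (hA : ∀ x y u v, u ∈ A x → v ∈ A y → (0 : ℝ) ≤ inner ℝ (u - v) (x - y))
    (x y u v : E) (hu : u ∈ lam • A x) (hv : v ∈ lam • A y) :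
    (0 : ℝ) ≤ inner ℝ (u - v) (x - y) := by
  obtain ⟨u, hu, rfl⟩ := hu
  obtain ⟨v, hv, rfl⟩ := hv
  simp only [← smul_sub, real_inner_smul_left]
  exact mul_nonneg hlam (hA x y u v hu hv)

theorem mem_subdiff_coe_iff {f : E → ℝ} {x a : E} :
    a ∈ subdiff (fun x => ((f x : ℝ) : EReal)) x ↔ ∀ y, inner ℝ a (y - x) + f x ≤ f y := by
  simp only [subdiff, mem_ofPred_eq]
  exact forall_congr' fun y => by norm_cast

theorem inner_eq_mul_real (s t : ℝ) : (inner ℝ s t : ℝ) = s * t := by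
  simp [mul_comm]

theorem conjugate_phi_of_nonneg {t : ℝ} (ht : 0 ≤ t) : conjugate phi t = 0 := by
  refine le_antisymm (iSup_le fun x => ?_) (le_iSup_of_le 0 ?_)
  · by_cases hx : x ∈ Iic (0 : ℝ)
    · have h1 : phi x = 0 := if_pos hx
      rw [h1, sub_zero]
      have h2 : inner ℝ t x ≤ (0 : ℝ) := by
        rw [inner_eq_mul_real]; exact mul_nonpos_of_nonneg_of_nonpos ht hx
      exact_mod_cast h2
    · have h1 : phi x = ⊤ := if_neg hx
      rw [h1, EReal.sub_top]
      exact bot_le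
  · have h1 : phi 0 = 0 := if_pos (mem_Iic.2 le_rfl)
    rw [h1, sub_zero, inner_zero_right]
    exact le_rfl

theorem conjugate_phi_of_neg {t : ℝ} (ht : t < 0) : conjugate phi t = ⊤ := by
  rw [EReal.eq_top_iff_forall_lt]
  intro c
  have hx : (|c| + 1) / t ≤ 0 := div_nonpos_of_nonneg_of_nonpos (by positivity) ht.le
  refine lt_of_lt_of_le ?_ (le_iSup _ ((|c| + 1) / t))
  have h1 : phi ((|c| + 1) / t) = 0 := if_pos hx
  rw [h1, sub_zero, EReal.coe_lt_coe_iff, inner_eq_mul_real, mul_div_cancel₀ _ ht.ne]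
  linarith [le_abs_self c]

/-- The conjugate is the indicator of `[0, ∞)`, whose normal cone is written here as
complementarity. For `t < 0` its value is `⊤`, and the test point `0` excludes every subgradient. -/
theorem mem_subdiff_conjugate_phi_iff {s t : ℝ} :
    s ∈ subdiff (conjugate phi) t ↔ 0 ≤ t ∧ s ≤ 0 ∧ s * t = 0 := by
  simp only [subdiff, mem_ofPred_eq, inner_eq_mul_real]
  constructor
  · intro h
    have ht : 0 ≤ t := by
      by_contra! ht
      have h1 := h 0
      rw [conjugate_phi_of_neg ht, conjugate_phi_of_nonneg le_rfl, EReal.coe_add_top] at h1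
      exact absurd h1 (by simp)
    have h1 : ∀ y, 0 ≤ y → s * (y - t) ≤ 0 := fun y hy => by
      have h2 := h y
      rw [conjugate_phi_of_nonneg ht, conjugate_phi_of_nonneg hy, add_zero] at h2
      exact_mod_cast h2
    have h2 := h1 (t + 1) (by linarith)
    have h3 := h1 0 le_rfl
    have h4 : s ≤ 0 := by linarith
    exact ⟨ht, h4, by nlinarith⟩
  · rintro ⟨ht, hs, hst⟩ y
    rw [conjugate_phi_of_nonneg ht, add_zero]
    rcases le_or_gt 0 y with hy | hy
    · rw [conjugate_phi_of_nonneg hy]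
      have h1 : s * (y - t) ≤ 0 := by nlinarith
      exact_mod_cast h1
    · rw [conjugate_phi_of_neg hy]; exact le_top

end SetOperators

/-! ### Monotonicity and resolvents of the concrete operators. -/

section ProductOperators

variable {H : Type*} [NormedAddCommGroup H] [InnerProductSpace ℝ H] {N : ℕ}

theorem inner_HR (z w : HR H N) :
    (inner ℝ z w : ℝ) = inner ℝ z.fst w.fst + inner ℝ z.snd w.snd := rfl

theorem HR_ext {H : Type*} {z w : HR H N} (h1 : z.fst = w.fst) (h2 : z.snd = w.snd) : z = w :=
  (WithLp.ofLp_injective 2) (Prod.ext h1 h2)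

theorem opA1_monotone {Q : Set H} (x y u v : HR H N) (hu : u ∈ opA1 Q x) (hv : v ∈ opA1 Q y) :
    (0 : ℝ) ≤ inner ℝ (u - v) (x - y) :=
  add_nonneg (normalCone_monotone hu.1 hv.1) (normalCone_monotone hu.2 hv.2)

theorem opA_monotone {P : Set (RN N)} (x y u v : HR H N) (hu : u ∈ opA P x) (hv : v ∈ opA P y) :
    (0 : ℝ) ≤ inner ℝ (u - v) (x - y) := by
  rw [inner_HR, WithLp.sub_fst, hu.1, hv.1, sub_zero, inner_zero_left, zero_add]
  exact normalCone_monotone hu.2 hv.2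

theorem mem_opB_iff {f : Fin N → H → ℝ} {i : Fin N} {z w : HR H N} :
    w ∈ opB f i z ↔ ∃ a s, (∀ y, inner ℝ a (y - z.fst) + f i z.fst ≤ f i y) ∧
      w.fst = z.snd i • a ∧ 0 ≤ z.snd i ∧ s ≤ 0 ∧ s * z.snd i = 0 ∧
      w.snd = EuclideanSpace.single i (s - f i z.fst) := by
  simp only [opB, mem_ofPred_eq, mem_smul_set, mem_subdiff_coe_iff, mem_subdiff_conjugate_phi_iff]
  have hs : ∀ s t : ℝ, (EuclideanSpace.single i s - EuclideanSpace.single i t : RN N) =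
      EuclideanSpace.single i (s - t) := fun s t => by
    ext j; by_cases h : j = i <;> simp [h]
  constructor
  · rintro ⟨⟨a, ha, h1⟩, s, ⟨h2, h3, h4⟩, h5⟩
    exact ⟨a, s, ha, h1.symm, h2, h3, h4, by rw [h5, hs]⟩
  · rintro ⟨a, s, ha, h1, h2, h3, h4, h5⟩
    exact ⟨⟨a, ha, h1.symm⟩, s, ⟨h2, h3, h4⟩, by rw [h5, hs]⟩

/-- The subgradient inequalities weighted by the nonnegative `p`-coordinates cancel the cross terms
in `f`; complementarity gives the rest the right sign. -/
theorem opB_monotone {f : Fin N → H → ℝ} {i : Fin N} (x y u v : HR H N) (hu : u ∈ opB f i x)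
    (hv : v ∈ opB f i y) : (0 : ℝ) ≤ inner ℝ (u - v) (x - y) := by
  obtain ⟨a, s, ha, h1, hx, hs, hsx, h2⟩ := mem_opB_iff.1 hu
  obtain ⟨a', s', ha', h1', hy, hs', hsy, h2'⟩ := mem_opB_iff.1 hv
  have e1 := ha y.fst
  have e2 := ha' x.fst
  rw [← neg_sub x.fst y.fst, inner_neg_right] at e1
  rw [inner_HR, WithLp.sub_fst, WithLp.sub_snd, h1, h1', h2, h2', inner_sub_left, inner_sub_left,
    EuclideanSpace.inner_single_left, EuclideanSpace.inner_single_left]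
  simp only [WithLp.sub_fst, WithLp.sub_snd, PiLp.sub_apply, real_inner_smul_left,
    conj_trivial]
  have e3 := mul_le_mul_of_nonneg_left e1 hx
  have e4 := mul_le_mul_of_nonneg_left e2 hy
  have e5 := mul_nonneg (neg_nonneg.2 hs) hy
  have e6 := mul_nonneg (neg_nonneg.2 hs') hx
  nlinarith

/-- Only the coordinate `i` of `p` moves, to `max 0 (u.snd i + lam * f i x)`; the multiplier `s` is
then dictated by that coordinate of the equation. -/
theorem exists_sub_mem_smul_opB [CompleteSpace H] {f : Fin N → H → ℝ} {i : Fin N} (hc : ConvexOn ℝ univ (f i))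
    (hl : LowerSemicontinuous (f i)) {lam : ℝ} (hlam : 0 < lam) (u : HR H N) :
    ∃ r, u - r ∈ lam • opB f i r := by
  obtain ⟨x, hx⟩ := exists_saddle_resolvent hc hl hlam u.fst (u.snd i)
  set p := max 0 (u.snd i + lam * f i x) with hp
  have hp0 : 0 ≤ p := le_max_left _ _
  obtain ⟨a, ha, hpa⟩ : ∃ a, (∀ y, inner ℝ a (y - x) + f i x ≤ f i y) ∧
      lam⁻¹ • (u.fst - x) = p • a := by
    -- If `p = 0`, then `x = u.fst`, but `0 • ∂f(x)` is `{0}` only when `∂f(x)` is nonempty. This is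
    -- where continuity of `f i` enters.
    rcases hp0.eq_or_lt with h | h
    · obtain ⟨a, ha⟩ := exists_subgradient hc
        (continuous_of_convexOn_of_lowerSemicontinuous hc hl) x
      refine ⟨a, ha, ?_⟩
      have h1 := hx u.fst
      rw [← h, zero_mul, mul_zero, real_inner_self_eq_norm_sq] at h1
      have h2 : ‖u.fst - x‖ = 0 := by nlinarith [norm_nonneg (u.fst - x)]
      rw [norm_eq_zero.1 h2, ← h, smul_zero, zero_smul]
    · refine ⟨p⁻¹ • lam⁻¹ • (u.fst - x), fun y => ?_, by rw [smul_inv_smul₀ h.ne']⟩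
      have h1 := hx y
      rw [real_inner_smul_left, real_inner_smul_left, ← le_sub_iff_add_le, inv_mul_le_iff₀ h,
        inv_mul_le_iff₀ hlam]
      exact h1
  set r : HR H N := WithLp.toLp 2 (x, u.snd + EuclideanSpace.single i (p - u.snd i)) with hr
  have hri : r.snd i = p := by
    change (u.snd + EuclideanSpace.single i (p - u.snd i) : RN N) i = p
    simp
  refine ⟨r, (mem_smul_set_iff_inv_smul_mem₀ hlam.ne' _ _).2 (mem_opB_iff.2
    ⟨a, f i x + lam⁻¹ * (u.snd i - p), ha, ?_, ?_, ?_, ?_, ?_⟩)⟩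
  · rw [hri]; exact hpa
  · rw [hri]; exact hp0
  · have h1 : u.snd i + lam * f i x ≤ p := le_max_right _ _
    have h2 : lam⁻¹ * (u.snd i - p) ≤ - f i x := by
      rw [inv_mul_le_iff₀ hlam]; linarith
    linarith
  · rw [hri]
    rcases hp0.eq_or_lt with h | h
    · rw [← h, mul_zero]
    · have h1 : p = u.snd i + lam * f i x := by
        rcases max_choice 0 (u.snd i + lam * f i x) with h2 | h2
        · exact absurd (hp.trans h2) h.ne'
        · exact hp.trans h2
      have h2 : f i x + lam⁻¹ * (u.snd i - p) = 0 := by rw [h1]; field_simp; ring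
      rw [h2, zero_mul]
  · change lam⁻¹ • (u.snd - (u.snd + EuclideanSpace.single i (p - u.snd i))) =
      EuclideanSpace.single i (f i x + lam⁻¹ * (u.snd i - p) - f i x)
    ext j
    by_cases h : j = i
    · subst h; simp; ring
    · simp [h]

theorem sub_mem_smul_opA1 [CompleteSpace H] {Q : Set H} (hne : Q.Nonempty) (hcl : IsClosed Q) (hcv : Convex ℝ Q)
    (hN : 1 ≤ N) {lam : ℝ} (hlam : 0 < lam) (u : HR H N) :
    u - WithLp.toLp 2 (proj Q u.fst, proj (P1 N) u.snd) ∈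
      lam • opA1 Q (WithLp.toLp 2 (proj Q u.fst, proj (P1 N) u.snd) : HR H N) := by
  have h1 : (P1 N).Nonempty := ⟨EuclideanSpace.single ⟨0, hN⟩ 1, by simp [P1]⟩
  have h2 : IsClosed (P1 N) := isClosed_eq (by fun_prop) continuous_const
  have h3 : Convex ℝ (P1 N) := by
    intro p hp q hq a b _ _ hab
    simp only [P1, mem_ofPred_eq] at *
    simp [Finset.sum_add_distrib, ← Finset.mul_sum, hp, hq, hab]
  rw [mem_smul_set_iff_inv_smul_mem₀ hlam.ne']
  exact ⟨smul_mem_normalCone (inv_nonneg.2 hlam.le) (sub_proj_mem_normalCone hne hcl hcv u.fst),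
    smul_mem_normalCone (inv_nonneg.2 hlam.le) (sub_proj_mem_normalCone h1 h2 h3 u.snd)⟩

theorem sub_mem_smul_opA {P : Set (RN N)} (hne : P.Nonempty) (hcl : IsClosed P)
    (hcv : Convex ℝ P) {lam : ℝ} (hlam : 0 < lam) (u : HR H N) :
    u - WithLp.toLp 2 (u.fst, proj P u.snd) ∈
      lam • opA P (WithLp.toLp 2 (u.fst, proj P u.snd) : HR H N) := by
  rw [mem_smul_set_iff_inv_smul_mem₀ hlam.ne']
  refine ⟨?_, smul_mem_normalCone (inv_nonneg.2 hlam.le) (sub_proj_mem_normalCone hne hcl hcv _)⟩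
  change lam⁻¹ • (u.fst - u.fst) = 0
  rw [sub_self, smul_zero]

theorem isClosed_P2 (q : RN N) : IsClosed (P2 q) := by
  simp only [P2, ofPred_forall]
  exact isClosed_iInter fun i => isClosed_le (by fun_prop) continuous_const

theorem convex_P2 (q : RN N) : Convex ℝ (P2 q) := by
  intro p hp r hr a b ha hb hab i
  have h1 := mul_le_mul_of_nonneg_left (hp i) ha
  have h2 := mul_le_mul_of_nonneg_left (hr i) hb
  have h3 : a * q i + b * q i = q i := by rw [← add_mul, hab, one_mul]
  simp only [PiLp.add_apply, PiLp.smul_apply, smul_eq_mul]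
  linarith

theorem isClosed_P3 (ξ : RN N) (μm μp : ℝ) : IsClosed (P3 ξ μm μp) := by
  have h : Continuous fun p : RN N => ∑ i, p i * ξ i := by fun_prop
  exact (isClosed_le continuous_const h).inter (isClosed_le h continuous_const)

theorem convex_P3 (ξ : RN N) (μm μp : ℝ) : Convex ℝ (P3 ξ μm μp) := by
  intro p hp r hr a b ha hb hab
  have h1 : ∑ i, (a • p + b • r) i * ξ i = a * ∑ i, p i * ξ i + b * ∑ i, r i * ξ i := by
    simp only [Finset.mul_sum, ← Finset.sum_add_distrib, PiLp.add_apply, PiLp.smul_apply,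
      smul_eq_mul]
    exact Finset.sum_congr rfl fun i _ => by ring
  have h2 := convex_Icc μm μp hp hr ha hb hab
  simp only [P3, mem_ofPred_eq, h1]
  exact h2

end ProductOperators

/-! ### Stationary configurations and zeros of the sum. -/

section Stationary

variable {E : Type*} [NormedAddCommGroup E]

theorem IsStationary.exists_sum_eq_zero {S : ℕ → E → Set E} {D : ℕ → E → E} {M : ℕ} {y : E}
    {w : ℕ → E} (h : IsStationary S D M y w) :
    ∃ s : ℕ → E, (∀ i ≤ M, s i ∈ S i y) ∧
      ∑ i ∈ Finset.range (M + 1), s i + ∑ i ∈ Finset.range M, D i y = 0 := by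
  refine ⟨fun i => Nat.casesOn i (w 0 - y) fun i => w (i + 1) - w i - D i y, ?_, ?_⟩
  · rintro (_ | i) hi
    · exact h.zero
    · exact h.succ i hi
  · rw [Finset.sum_range_succ']
    change ∑ i ∈ Finset.range M, (w (i + 1) - w i - D i y) + (w 0 - y) + _ = 0
    rw [Finset.sum_sub_distrib, Finset.sum_range_sub, h.last]
    abel

/-- The governing points are `y` plus partial sums of the chosen values; the zero total closes the
ring at `w M = y`. -/
theorem exists_isStationary_of_sum_eq_zero {S : ℕ → E → Set E} {D : ℕ → E → E} {M : ℕ} {y : E}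
    {s : ℕ → E} (hs : ∀ i ≤ M, s i ∈ S i y)
    (h0 : ∑ i ∈ Finset.range (M + 1), s i + ∑ i ∈ Finset.range M, D i y = 0) :
    ∃ w, IsStationary S D M y w := by
  refine ⟨fun i => y + (∑ j ∈ Finset.range (i + 1), s j + ∑ j ∈ Finset.range i, D j y),
    ?_, ?_, fun i hi => ?_⟩
  · rw [h0, add_zero]
  · simpa using hs 0 (Nat.zero_le _)
  · convert hs (i + 1) hi using 1
    rw [Finset.sum_range_succ _ (i + 1), Finset.sum_range_succ (fun j => D j y)]
    abel

end Stationary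

/-! ### The routine as a ring splitting. -/

section Main

variable {H : Type*} [NormedAddCommGroup H] [InnerProductSpace ℝ H] [CompleteSpace H] {N : ℕ}

/-- The set-valued operators of the routine, scaled by the step size and counted from `0`. -/
def scaledOp (Q : Set H) (f : Fin N → H → ℝ) (P : Set (RN N)) (lam : ℝ) :
    ℕ → HR H N → Set (HR H N)
  | 0, z => lam • opA1 Q z
  | 1, z => lam • opA P z
  | i + 2, z => if hi : i < N then lam • opB f ⟨i, hi⟩ z else ∅

/-- The single-valued operators of the routine, scaled by the step size and counted from `0`. -/
noncomputable def scaledSingle (h : H → ℝ) (lam : ℝ) : ℕ → HR H N → HR H N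
  | 0, z => lam • opC h z
  | _ + 1, _ => 0

variable {Q : Set H} {h : H → ℝ} {f : Fin N → H → ℝ} {P : Set (RN N)} {lam γ β : ℝ}

theorem scaledOp_add_two {H : Type*} [NormedAddCommGroup H] [InnerProductSpace ℝ H] {Q : Set H}
    {f : Fin N → H → ℝ} (i : Fin N) (z : HR H N) :
    scaledOp Q f P lam (i + 2) z = lam • opB f i z :=
  dif_pos i.2

theorem sum_opCi (z : HR H N) : ∑ i ∈ Finset.Icc 1 (N + 1), opCi h i z = opC h z := by
  rw [Finset.sum_eq_single 1]
  · exact if_pos rfl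
  · intro i _ hi; exact if_neg hi
  · intro hi; exact absurd (Finset.mem_Icc.2 ⟨le_rfl, by omega⟩) hi

theorem sum_scaledSingle (z : HR H N) :
    ∑ i ∈ Finset.range (N + 1), scaledSingle h lam i z = lam • opC h z := by
  rw [Finset.sum_range_succ']
  simp [scaledSingle]

theorem solvesInclusion_iff {z : HR H N} : SolvesInclusion Q h f P z ↔
    ∃ a ∈ opA1 Q z, ∃ a' ∈ opA P z, ∃ g : Fin N → HR H N, (∀ i, g i ∈ opB f i z) ∧
      a + a' + ∑ i, g i + opC h z = 0 := by
  rw [SolvesInclusion, sum_opCi]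
  simp only [add_singleton, mem_image, Set.mem_add]
  constructor
  · rintro ⟨_, ⟨_, ⟨a, ha, a', ha', rfl⟩, _, hg, rfl⟩, h0⟩
    obtain ⟨g, hg', rfl⟩ := (mem_finsetSum _ _ _).1 hg
    exact ⟨a, ha, a', ha', g, fun i => hg' (Finset.mem_univ i), h0⟩
  · rintro ⟨a, ha, a', ha', g, hg, h0⟩
    exact ⟨_, ⟨_, ⟨a, ha, a', ha', rfl⟩, _,
      (mem_finsetSum _ _ _).2 ⟨g, fun {i} _ => hg i, rfl⟩, rfl⟩, h0⟩

theorem exists_isStationary_iff (hlam : 0 < lam) {z : HR H N} :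
    (∃ w, IsStationary (scaledOp Q f P lam) (scaledSingle h lam) (N + 1) z w) ↔
      SolvesInclusion Q h f P z := by
  rw [solvesInclusion_iff]
  constructor
  · rintro ⟨w, hw⟩
    obtain ⟨s, hs, h0⟩ := hw.exists_sum_eq_zero
    refine ⟨lam⁻¹ • s 0, ?_, lam⁻¹ • s 1, ?_, fun i => lam⁻¹ • s (i + 2), fun i => ?_, ?_⟩
    · exact (mem_smul_set_iff_inv_smul_mem₀ hlam.ne' _ _).1 (hs 0 (by omega))
    · exact (mem_smul_set_iff_inv_smul_mem₀ hlam.ne' _ _).1 (hs 1 (by omega))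
    · have := hs (i + 2) (by omega)
      rw [scaledOp_add_two] at this
      exact (mem_smul_set_iff_inv_smul_mem₀ hlam.ne' _ _).1 this
    · rw [sum_scaledSingle, Finset.sum_range_succ', Finset.sum_range_succ',
        Finset.sum_range fun i => s (i + 1 + 1)] at h0
      have h1 : opC h z = lam⁻¹ • lam • opC h z := (inv_smul_smul₀ hlam.ne' _).symm
      rw [h1, ← Finset.smul_sum, ← smul_add, ← smul_add, ← smul_add]
      refine (congrArg (lam⁻¹ • ·) (Eq.trans ?_ h0)).trans (smul_zero _)
      simp only [zero_add, add_assoc, one_add_one_eq_two]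
      abel
  · rintro ⟨a, ha, a', ha', g, hg, h0⟩
    let s : ℕ → HR H N
      | 0 => lam • a
      | 1 => lam • a'
      | i + 2 => if hi : i < N then lam • g ⟨i, hi⟩ else 0
    refine exists_isStationary_of_sum_eq_zero (s := s) ?_ ?_
    · rintro (_ | _ | i) hi
      · exact smul_mem_smul_set ha
      · exact smul_mem_smul_set ha'
      · have hi' : i < N := by omega
        have h1 : s (i + 2) = lam • g ⟨i, hi'⟩ := dif_pos hi'
        have h2 := scaledOp_add_two (Q := Q) (f := f) (P := P) (lam := lam) ⟨i, hi'⟩ z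
        change s (i + 2) ∈ scaledOp Q f P lam (i + 2) z
        dsimp only at h2
        rw [h1, h2]
        exact smul_mem_smul_set (hg _)
    · rw [sum_scaledSingle, Finset.sum_range_succ', Finset.sum_range_succ',
        Finset.sum_range fun i => s (i + 1 + 1)]
      have h1 : ∀ i : Fin N, s (i + 1 + 1) = lam • g i := fun i => dif_pos i.2
      have h2 : s 0 = lam • a := rfl
      have h3 : s (0 + 1) = lam • a' := rfl
      simp only [h1]
      rw [h2, h3, ← Finset.smul_sum, ← smul_add, ← smul_add, ← smul_add]
      refine (congrArg (lam • ·) (Eq.trans ?_ h0)).trans (smul_zero _)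
      abel

theorem isSplittingData (hN : 1 ≤ N) (hQne : Q.Nonempty) (hQcl : IsClosed Q)
    (hQcv : Convex ℝ Q) (hhc : ConvexOn ℝ univ h) (hhd : Differentiable ℝ h) (hβ : 0 < β)
    (hhL : ∀ x y : H, ‖gradient h x - gradient h y‖ ≤ β⁻¹ * ‖x - y‖)
    (hfc : ∀ i, ConvexOn ℝ univ (f i)) (hfl : ∀ i, LowerSemicontinuous (f i))
    (hPne : P.Nonempty) (hPcl : IsClosed P) (hPcv : Convex ℝ P) (hlam : 0 < lam) :
    IsSplittingData (scaledOp Q f P lam) (scaledSingle h lam) (N + 1) (β / lam) where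
  mono := by
    rintro (_ | _ | i) hi
    · exact smul_monotone hlam.le opA1_monotone
    · exact smul_monotone hlam.le opA_monotone
    · have hi' : i < N := by omega
      intro x y u v hu hv
      rw [show i + 1 + 1 = ((⟨i, hi'⟩ : Fin N) : ℕ) + 2 from rfl, scaledOp_add_two] at hu hv
      exact smul_monotone hlam.le opB_monotone x y u v hu hv
  surj := by
    rintro (_ | _ | i) hi u
    · exact ⟨_, sub_mem_smul_opA1 hQne hQcl hQcv hN hlam u⟩
    · exact ⟨_, sub_mem_smul_opA hPne hPcl hPcv hlam u⟩
    · have hi' : i < N := by omega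
      obtain ⟨r, hr⟩ := exists_sub_mem_smul_opB (hfc ⟨i, hi'⟩) (hfl ⟨i, hi'⟩) hlam u
      refine ⟨r, ?_⟩
      rw [show i + 1 + 1 = ((⟨i, hi'⟩ : Fin N) : ℕ) + 2 from rfl, scaledOp_add_two]
      exact hr
  coco := by
    rintro (_ | i) hi x y
    · have h1 := gradient_cocoercive hhc hhd hβ hhL x.fst y.fst
      have h2 : opC h x - opC h y =
          (WithLp.toLp 2 (gradient h x.fst - gradient h y.fst, 0) : HR H N) :=
        HR_ext rfl (sub_zero 0)
      have h3 : ‖opC h x - opC h y‖ ^ 2 = ‖gradient h x.fst - gradient h y.fst‖ ^ 2 := by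
        rw [h2, ← real_inner_self_eq_norm_sq, inner_HR, ← real_inner_self_eq_norm_sq]
        simp
      have h4 : (inner ℝ (opC h x - opC h y) (x - y) : ℝ) =
          inner ℝ (gradient h x.fst - gradient h y.fst) (x.fst - y.fst) := by
        rw [h2, inner_HR]; simp only [WithLp.toLp_snd, inner_zero_left, add_zero]; rfl
      change β / lam * ‖lam • opC h x - lam • opC h y‖ ^ 2 ≤
        inner ℝ (lam • opC h x - lam • opC h y) (x - y)
      rw [← smul_sub, norm_smul, mul_pow, real_inner_smul_left, h3, h4,
        Real.norm_of_nonneg hlam.le]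
      have h5 := mul_le_mul_of_nonneg_left h1 hlam.le
      refine le_trans (le_of_eq ?_) h5
      field_simp
    · simp [scaledSingle]

/-- Indices shift down by one. The extra governing point, at index `N + 1`, is `z k 1`, as in the
last resolvent of the routine. -/
theorem isRingIteration (hN : 1 ≤ N) (hQne : Q.Nonempty) (hQcl : IsClosed Q)
    (hQcv : Convex ℝ Q)
    (hfc : ∀ i, ConvexOn ℝ univ (f i)) (hfl : ∀ i, LowerSemicontinuous (f i))
    (hPne : P.Nonempty) (hPcl : IsClosed P) (hPcv : Convex ℝ P) (hlam : 0 < lam)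
    {zbar z : ℕ → ℕ → HR H N} (hr : IsRoutine Q h f P lam γ zbar z) :
    IsRingIteration (scaledOp Q f P lam) (scaledSingle h lam) (N + 1) γ
      (fun k i => if i ≤ N then zbar k (i + 1) else z k 1) (fun k i => z k (i + 1)) where
  last k := by simp
  zero k := by
    have h1 := sub_mem_smul_opA1 hQne hQcl hQcv hN hlam (zbar k 1)
    rw [← hr.first k] at h1
    exact h1
  succ k := by
    rintro (_ | i) hi
    · have h1 := sub_mem_smul_opA hPne hPcl hPcv hlam
        (zbar k 2 + z k 1 - zbar k 1 - lam • opC h (z k 1))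
      have h2 : WithLp.toLp 2 ((zbar k 2 + z k 1 - zbar k 1 - lam • opC h (z k 1)).fst,
          proj P (zbar k 2 + z k 1 - zbar k 1 - lam • opC h (z k 1)).snd) = z k 2 := by
        have h3 : (zbar k 2 + z k 1 - zbar k 1 - lam • opC h (z k 1)).snd =
            (zbar k 2).snd + (z k 1).snd - (zbar k 1).snd := by
          change (zbar k 2).snd + (z k 1).snd - (zbar k 1).snd - lam • (0 : RN N) = _
          rw [smul_zero, sub_zero]
        rw [hr.second k, h3]
        rfl
      rw [h2] at h1
      have h4 : (0 : ℕ) + 1 ≤ N := hN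
      simp only [h4, Nat.zero_le, if_true]
      change _ ∈ lam • opA P (z k 2)
      convert h1 using 1
      change _ - lam • opC h (z k 1) = _
      abel
    · have hi' : i < N := by omega
      have hle : i + 1 ≤ N := hi'
      change (if i + 2 ≤ N then zbar k (i + 3) else z k 1) - z k (i + 3) -
        ((if i + 1 ≤ N then zbar k (i + 2) else z k 1) - z k (i + 2)) - 0 ∈
        scaledOp Q f P lam (((⟨i, hi'⟩ : Fin N) : ℕ) + 2) (z k (i + 3))
      rw [scaledOp_add_two, if_pos hle]
      have key := fun u => sub_resolvent_mem
        (exists_sub_mem_smul_opB (hfc ⟨i, hi'⟩) (hfl ⟨i, hi'⟩) hlam u)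
      rcases Nat.lt_or_ge (i + 1) N with hlt | hge
      · have h1 := key (zbar k (i + 3) + z k (i + 2) - zbar k (i + 2))
        rw [← hr.middle k ⟨i, hi'⟩ hlt] at h1
        rw [if_pos (show i + 2 ≤ N from hlt)]
        convert h1 using 1
        abel
      · obtain rfl : N = i + 1 := by omega
        have h1 := key (z k 1 + z k (i + 1 + 1) - zbar k (i + 1 + 1))
        rw [← hr.last k ⟨i, hi'⟩ rfl] at h1
        rw [if_neg (by omega)]
        convert h1 using 1
        abel
  update k i hi := by
    have hi' : i ≤ N := by omega
    simp only [hi', if_true]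
    exact hr.update k (i + 1) (by omega) (by omega)

theorem weaklyConverges_of_tendsto_inner {E : Type*} [NormedAddCommGroup E]
    [InnerProductSpace ℝ E] [CompleteSpace E] {u : ℕ → E} {x : E}
    (h : ∀ v, Tendsto (fun k => inner ℝ (u k) v) atTop (𝓝 (inner ℝ x v))) :
    WeaklyConverges u x := by
  have hinj : Function.Injective (topDualPairing ℝ E).flip := fun x y hxy =>
    ext_inner_left ℝ fun v => LinearMap.congr_fun hxy (InnerProductSpace.toDual ℝ E v)
  refine (WeakBilin.tendsto_iff_forall_eval_tendsto _ hinj).2 fun l => ?_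
  have h1 := h ((InnerProductSpace.toDual ℝ E).symm l)
  simp only [real_inner_comm ((InnerProductSpace.toDual ℝ E).symm l),
    InnerProductSpace.toDual_symm_apply] at h1
  exact h1

/-- Weak convergence of the routine for a closed convex set `P`. -/
theorem exists_solution_weaklyConverges (hN : 1 ≤ N) (hQne : Q.Nonempty) (hQcl : IsClosed Q)
    (hQcv : Convex ℝ Q) (hhc : ConvexOn ℝ univ h) (hhd : Differentiable ℝ h) (hβ : 0 < β)
    (hhL : ∀ x y : H, ‖gradient h x - gradient h y‖ ≤ β⁻¹ * ‖x - y‖)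
    (hfc : ∀ i, ConvexOn ℝ univ (f i)) (hfl : ∀ i, LowerSemicontinuous (f i))
    (hPcl : IsClosed P) (hPcv : Convex ℝ P)
    (hlam : lam ∈ Ioo 0 (2 * β)) (hγ : γ ∈ Ioo 0 (1 - lam / (2 * β)))
    {zbar z : ℕ → ℕ → HR H N} (hex : ∃ w, SolvesInclusion Q h f P w)
    (hr : IsRoutine Q h f P lam γ zbar z) :
    ∃ w, SolvesInclusion Q h f P w ∧ WeaklyConverges (fun k => z k 1) w := by
  obtain ⟨w₀, hw₀⟩ := hex
  -- A solution has its second component in `P`, since normal cones are empty off the set.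
  have hPne : P.Nonempty := by
    obtain ⟨_, _, a', ha', _⟩ := solvesInclusion_iff.1 hw₀
    exact ⟨_, ha'.2.1⟩
  obtain ⟨v₀, hv₀⟩ := (exists_isStationary_iff hlam.1).2 hw₀
  have h1 : lam / (2 * β) < 1 - γ := by linarith [hγ.2]
  have h2 : 0 < lam / (2 * β) := div_pos hlam.1 (by linarith)
  -- The scaled gradient is `β / lam`-cocoercive; the bound on `γ` is exactly positivity of the
  -- determinant in `exists_quadratic_bound`.
  have h3 : 1 < 2 * (β / lam) * (1 - γ) := by
    rw [div_lt_iff₀ (by linarith)] at h1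
    rw [mul_div_assoc', div_mul_eq_mul_div, one_lt_div hlam.1]
    linarith
  obtain ⟨y, w, hst, hlim⟩ := exists_weak_limit_isStationary (Nat.succ_pos N)
    (isSplittingData hN hQne hQcl hQcv hhc hhd hβ hhL hfc hfl hPne hPcl hPcv hlam.1)
    (isRingIteration hN hQne hQcl hQcv hfc hfl hPne hPcl hPcv hlam.1 hr)
    (div_pos hβ hlam.1) hγ.1 (by linarith) h3 ⟨w₀, v₀, hv₀⟩
  exact ⟨y, (exists_isStationary_iff hlam.1).1 ⟨w, hst⟩, weaklyConverges_of_tendsto_inner hlim⟩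

end Main

end DRO

theorem mainTheorem9 {H : Type*} [NormedAddCommGroup H] [InnerProductSpace ℝ H] [CompleteSpace H]
    {N : ℕ} (hN : 1 ≤ N)
    (Q : Set H) (hQ_nonempty : Q.Nonempty) (hQ_closed : IsClosed Q) (hQ_convex : Convex ℝ Q)
    (h : H → ℝ) (h_convex : ConvexOn ℝ Set.univ h) (h_diff : Differentiable ℝ h)
    (β : ℝ) (hβ : 0 < β)
    (h_lip : ∀ x y : H, ‖gradient h x - gradient h y‖ ≤ β⁻¹ * ‖x - y‖)
    (f : Fin N → H → ℝ) (hf_convex : ∀ i, ConvexOn ℝ Set.univ (f i))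
    (hf_lsc : ∀ i, LowerSemicontinuous (f i))
    (q : DRO.RN N) (ξ : DRO.RN N) (μm μp : ℝ)
    (lam : ℝ) (hlam : lam ∈ Set.Ioo 0 (2 * β))
    (γ : ℝ) (hγ : γ ∈ Set.Ioo 0 (1 - lam / (2 * β)))
    (zbar z : ℕ → ℕ → DRO.HR H N) :
    ((∃ w, DRO.SolvesInclusion Q h f (DRO.P2 q) w) →
      DRO.IsRoutine Q h f (DRO.P2 q) lam γ zbar z →
      ∃ w, DRO.SolvesInclusion Q h f (DRO.P2 q) w ∧ DRO.WeaklyConverges (fun k => z k 1) w) ∧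
    ((∃ w, DRO.SolvesInclusion Q h f (DRO.P3 ξ μm μp) w) →
      DRO.IsRoutine Q h f (DRO.P3 ξ μm μp) lam γ zbar z →
      ∃ w, DRO.SolvesInclusion Q h f (DRO.P3 ξ μm μp) w ∧
        DRO.WeaklyConverges (fun k => z k 1) w) := by
  exact ⟨
  DRO.exists_solution_weaklyConverges hN hQ_nonempty hQ_closed hQ_convex h_convex h_diff hβ h_lip
    hf_convex hf_lsc (DRO.isClosed_P2 q) (DRO.convex_P2 q) hlam hγ,
  DRO.exists_solution_weaklyConverges hN hQ_nonempty hQ_closed hQ_convex h_convex h_diff hβ h_lip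
    hf_convex hf_lsc (DRO.isClosed_P3 ξ μm μp) (DRO.convex_P3 ξ μm μp) hlam hγ⟩
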